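/- **Definitions.** A $2$-$(v,k,\lambda)$ design ($2\le k<v$, $\lambda>0$) consists of a set of $v$ points and a set of $k$-subsets of it (blocks) such that any two distinct points lie in exactly $\lambda$ blocks. A permutation group $H$ on a set $\mathscr P$ is *$s$-grid-imprimitive* ($s\ge 2$) if $\mathscr P$ can be identified with a product $\mathscr E_1\times\dots\times\mathscr E_s$ of finite sets with all $|\mathscr E_i|>1$ in such a way that $H\le \mathrm{Sym}(\mathscr E_1)\times\dots\times\mathrm{Sym}(\mathscr E_s)$ in its product action. A design is *block-transitive, $s$-grid-imprimitive* if some $s$-grid-imprimitive group of automorphisms of it is transitive on its blocks. For $e_1,\dots,e_s>1$ and $B\subseteq\mathscr P=\prod_{i=1}^s\mathbb Z_{e_i}$ let $\mathscr D(B,G)$ be the incidence structure with point set $\mathscr P$ and block set $\{B^g : g\in G\}$, where $G=\prod_{i=1}^s \mathrm{Sym}(\mathbb Z_{e_i})$ in product action. Points of $\mathscr P$ are written by integer representatives of their coordinates. **The structures $\mathscr D(3,p)$.** For an integer $p>1$ let $(e_1,e_2,e_3)=(p^2+p+1,\ p^2-p+1,\ p^4-p^2+1)$, $m=\frac{p^2-p}{2}$,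 and $\mathscr D(3,p)=\mathscr D(B_1\cup B_2\cup B_3,G)$, where * $B_1=\{(a,0,0): 0\le a\le p\}$ and $B_2=\{(p+a,2a-1,0),\,(p+a,2a,0): 1\le a\le m\}$; * if $p=2$, then $B_3=\{(3+a,b,c-1),\,(3+a,b,c): 1\le a\le 3,\ 1\le b\le 2,\ c=2(a+3(b-1))\}$; * if $p>2$, put $r=\frac{p^2-1}{2}$ for odd $p$ and $r=\frac{p^2-2p}{2}$ for even $p$; then $B_3$ is the union of the following four sets: * $(a,b,c-1),(a,b,c)$ for $1\le a\le p$, $1\le b\le r$, $c=2(a+(b-1)p)$; * $(p+a,b+\delta,c-1),(p+a,b+\delta,c)$ for $1\le a,b\le m$, $c=2pr+2(a+(b-1)m)$, with $\delta=m$ if $b\in\{2a-1,2a\}$ and $\delta=0$ otherwise; * $(p+m+a,r+b,c-1),(p+m+a,r+b,c)$ for $1\le a\le p$, $1\le b\le 2m-r$, $c=2pr+2m^2+2(a+(b-1)p)$; * $(2p+m+a,b+\delta,c-1),(2p+m+a,b+\delta,c)$ for $1\le a,b\le m$, $c=2m^2+4pm+2(a+(b-1)m)$, with $\delta=0$ if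 $a=1$ and $\delta=m$ otherwise. **The structure $\mathscr D(4,2)$.** Let $(e_1,e_2,e_3,e_4)=(7,3,13,241)$ and $\mathscr D(4,2)=\mathscr D(B,G)$, where $B$ consists of the $17$ points $(0,0,0,0)$, $(1,0,0,0)$, $(2,0,0,0)$, $(3,1,0,0)$, $(3,2,0,0)$, and $(3+a,b,c-1,0)$, $(3+a,b,c,0)$ for $1\le a\le3$, $1\le b\le 2$, $c=2(b+2(a-1))$, together with the $240$ points $(a,b,c,d-1)$, $(a,b,c,d)$ for $a,b,c,d$ as follows: | $(a,b)$ | range of $c$ and value of $d$ | |---|---| | $(0,0)$ | $9\le c\le12$, $d=2c-16$ | | $(1,0)$ | $1\le c\le4$, $d=2c+8$ | | $(2,0)$ | $5\le c\le8$, $d=2c+8$ | | $(0,1)$ | $5\le c\le8$, $d=2c+16$; $\ 11\le c\le12$, $d=2c+12$ | | $(1,1)$ | $3\le c\le4$, $d=2c+32$; $\ 9\le c\le12$, $d=2c+24$ | | $(2,1)$ | $1\le c\le4$, $d=2c+48$; $\ 7\le c\le8$, $d=2c+44$ | | $(0,2)$ | $5\le c\le10$, $d=2c+52$ | | $(1,2)$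 | $1\le c\le2$, $d=2c+72$; $\ 9\le c\le12$, $d=2c+60$ | | $(2,2)$ | $1\le c\le6$, $d=2c+84$ | | $(3,0)$ | $1\le c\le12$, $d=2c+96$ | | $(3,1)$ | $3\le c\le4$, $d=2c+116$; $\ 7\le c\le8$, $d=2c+112$; $\ 11\le c\le12$, $d=2c+108$ | | $(3,2)$ | $1\le c\le2$, $d=2c+132$; $\ 5\le c\le6$, $d=2c+128$; $\ 9\le c\le10$, $d=2c+124$ | | $(4,0)$ | $9\le c\le12$, $d=2c+128$ | | $(5,0)$ | $1\le c\le4$, $d=2c+152$ | | $(6,0)$ | $5\le c\le8$, $d=2c+152$ | | $(4,1)$ | $5\le c\le8$, $d=2c+160$; $\ 11\le c\le12$, $d=2c+156$ | | $(5,1)$ | $3\le c\le4$, $d=2c+176$; $\ 9\le c\le12$, $d=2c+168$ | | $(6,1)$ | $1\le c\le4$, $d=2c+192$; $\ 7\le c\le8$, $d=2c+188$ | | $(4,2)$ | $5\le c\le10$, $d=2c+196$ | | $(5,2)$ | $1\le c\le2$, $d=2c+216$; $\ 9\le c\le12$, $d=2c+204$ | | $(6,2)$ | $1\le c\le6$,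 $d=2c+228$ | **Theorem.** There are infinitely many block-transitive, $3$-grid-imprimitive $2$-designs: for every integer $p>1$, $\mathscr D(3,p)$ is a block-transitive, $3$-grid-imprimitive $2$-$(v,k,\lambda)$ design with $v=p^8+p^4+1$ and $k=p^4+1$, for some $\lambda$, and $\mathscr D(3,p)$ and $\mathscr D(3,q)$ are not isomorphic if $p\ne q$ are integers $>1$. There is also at least one block-transitive, $4$-grid-imprimitive $2$-design: $\mathscr D(4,2)$ is a block-transitive, $4$-grid-imprimitive $2$-$(v,k,\lambda)$ design with $v=2^{16}+2^8+1$ and $k=257$, for some $\lambda$. -/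

import Mathlib

/-- A point-block incidence structure: a point set `P` and a set of blocks, each block being a
subset of `P`, with incidence given by membership. -/
structure IncStructure (P : Type*) where
  /-- the set of blocks -/
  blocks : Set (Set P)

namespace IncStructure

variable {P : Type*}

/-- `D` is a `2`-`(v, k, lam)` design: there are `v` points, every block has `k` points, and any two
distinct points lie together in exactly `lam` blocks, where `2 ≤ k < v` and `lam > 0`. -/
structure IsTwoDesign (D : IncStructure P) (v k lam : ℕ) : Prop where
  card_points : Nat.card P = v
  two_le : 2 ≤ k
  lt_card : k < v
  lam_pos : 0 < lam
  card_block : ∀ b ∈ D.blocks, b.ncard = k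
  card_through : ∀ x y : P, x ≠ y → {b ∈ D.blocks | x ∈ b ∧ y ∈ b}.ncard = lam

/-- The permutation group `H` consists of automorphisms of `D`. -/
def IsAutGroup (D : IncStructure P) (H : Subgroup (Equiv.Perm P)) : Prop :=
  ∀ h ∈ H, ∀ b : Set P, h '' b ∈ D.blocks ↔ b ∈ D.blocks

/-- The permutation group `H` acts transitively on the blocks of `D`. -/
def IsTransitiveOnBlocks (D : IncStructure P) (H : Subgroup (Equiv.Perm P)) : Prop :=
  ∀ b ∈ D.blocks, ∀ b' ∈ D.blocks, ∃ h ∈ H, h '' b = b'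

/-- Isomorphism of incidence structures: a bijection of points mapping the block set of the first
onto the block set of the second. -/
def Isomorphic {Q : Type*} (D : IncStructure P) (D' : IncStructure Q) : Prop :=
  ∃ φ : P ≃ Q, D'.blocks = (fun b : Set P => φ '' b) '' D.blocks

end IncStructure

/-- The group `∏ i, Sym (E i)` in its product action on the grid `∏ i, E i`, as a group of
permutations of the grid. -/
def gridGroup {ι : Type*} (E : ι → Type*) : Subgroup (Equiv.Perm (∀ i, E i)) where
  carrier := {h | ∃ g : ∀ i, Equiv.Perm (E i), ∀ x i, h x i = g i (x i)}
  one_mem' := ⟨fun _ => 1, fun _ _ => rfl⟩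
  mul_mem' := by
    rintro h h' ⟨g, hg⟩ ⟨g', hg'⟩
    exact ⟨fun i => g i * g' i, fun x i => by simp [hg, hg']⟩
  inv_mem' := by
    rintro h ⟨g, hg⟩
    refine ⟨fun i => (g i)⁻¹, fun x i => ?_⟩
    have h1 := hg (h⁻¹ x) i
    have h2 : h (h⁻¹ x) = x := h.apply_symm_apply x
    rw [h2] at h1
    rw [h1]
    exact ((g i).symm_apply_apply _).symm

/-- A permutation group `H` on `P` is `s`-grid-imprimitive: `s ≥ 2` and `P` can be identified with an
`s`-dimensional grid, a product of `s` finite sets of sizes `e i > 1`, in such a way that `H` is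
contained in the direct product of the symmetric groups of the factors in its product action. -/
def IsGridImprimitive {P : Type*} (s : ℕ) (H : Subgroup (Equiv.Perm P)) : Prop :=
  2 ≤ s ∧ ∃ e : Fin s → ℕ, (∀ i, 1 < e i) ∧ ∃ φ : P ≃ (∀ i, Fin (e i)),
    ∀ h ∈ H, φ.permCongr h ∈ gridGroup (fun i => Fin (e i))

/-- `D` is block-transitive and `s`-grid-imprimitive: some `s`-grid-imprimitive group of
automorphisms of `D` is transitive on the blocks. -/
def IncStructure.IsBlockTransitiveGridImprimitive {P : Type*} (D : IncStructure P) (s : ℕ) : Prop :=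
  ∃ H : Subgroup (Equiv.Perm P),
    D.IsAutGroup H ∧ D.IsTransitiveOnBlocks H ∧ IsGridImprimitive s H

/-- The incidence structure `𝒟(B, H)` whose blocks are the images of `B` under `H`. -/
def orbitStructure {P : Type*} (B : Set P) (H : Subgroup (Equiv.Perm P)) : IncStructure P where
  blocks := {b | ∃ h ∈ H, b = h '' B}

/-- The point set `∏ i, ℤ/(e i)`. -/
abbrev Grid {s : ℕ} (e : Fin s → ℕ) : Type := ∀ i, ZMod (e i)

/-- The point of the grid with the given integer coordinates. -/
def gridPoint {s : ℕ} (e : Fin s → ℕ) (a : Fin s → ℕ) : Grid e := fun i => (a i : ZMod (e i))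

/-- `𝒟(B, G)` for the full group `G = ∏ i, Sym (ℤ/(e i))`, where the points of the base block `B`
are given by their integer coordinates. -/
def gridStructure {s : ℕ} (e : Fin s → ℕ) (B : Finset (Fin s → ℕ)) : IncStructure (Grid e) :=
  orbitStructure (gridPoint e '' (B : Set (Fin s → ℕ))) (gridGroup fun i => ZMod (e i))

/-- The grid sizes `p² + p + 1`, `p² - p + 1`, `p⁴ - p² + 1`. -/
def sizes3 (p : ℕ) : Fin 3 → ℕ := ![p ^ 2 + p + 1, p ^ 2 - p + 1, p ^ 4 - p ^ 2 + 1]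

/-- The set `B₁`, the points `(a, 0, 0)` with `0 ≤ a ≤ p`. -/
def block1 (p : ℕ) : Finset (Fin 3 → ℕ) :=
  (Finset.Icc 0 p).image fun a => ![a, 0, 0]

/-- The set `B₂`, the points `(p + a, 2a - 1, 0)` and `(p + a, 2a, 0)` with
`1 ≤ a ≤ (p² - p) / 2`. -/
def block2 (p : ℕ) : Finset (Fin 3 → ℕ) :=
  (Finset.Icc 1 ((p ^ 2 - p) / 2)).biUnion fun a => {![p + a, 2 * a - 1, 0], ![p + a, 2 * a, 0]}

/-- The set `B₃` for `p = 2`. -/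
def block3Two : Finset (Fin 3 → ℕ) :=
  (Finset.Icc 1 3 ×ˢ Finset.Icc 1 2).biUnion fun (a, b) =>
    let c := 2 * (a + 3 * (b - 1))
    {![3 + a, b, c - 1], ![3 + a, b, c]}

/-- The set `B₃ = B₃,₁ ∪ B₃,₂ ∪ B₃,₃ ∪ B₃,₄` for `p > 2`. Here `m = (p² - p) / 2`, and `r` is the
number of rows `1, …, r` met by `B₃,₁`; the set `B₃,₃` meets the remaining `2 m - r` nonzero rows. -/
def block3Gen (p : ℕ) : Finset (Fin 3 → ℕ) :=
  let m := (p ^ 2 - p) / 2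
  let r := if p % 2 = 1 then (p ^ 2 - 1) / 2 else (p ^ 2 - 2 * p) / 2
  ((Finset.Icc 1 p ×ˢ Finset.Icc 1 r).biUnion fun (a, b) =>
    let c := 2 * (a + (b - 1) * p)
    {![a, b, c - 1], ![a, b, c]}) ∪
  ((Finset.Icc 1 m ×ˢ Finset.Icc 1 m).biUnion fun (a, b) =>
    let c := 2 * p * r + 2 * (a + (b - 1) * m)
    let d := if b = 2 * a - 1 ∨ b = 2 * a then m else 0
    {![p + a, b + d, c - 1], ![p + a, b + d, c]}) ∪
  ((Finset.Icc 1 p ×ˢ Finset.Icc 1 (2 * m - r)).biUnion fun (a, b) =>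
    let c := 2 * p * r + 2 * m ^ 2 + 2 * (a + (b - 1) * p)
    {![p + m + a, r + b, c - 1], ![p + m + a, r + b, c]}) ∪
  ((Finset.Icc 1 m ×ˢ Finset.Icc 1 m).biUnion fun (a, b) =>
    let c := 2 * m ^ 2 + 4 * p * m + 2 * (a + (b - 1) * m)
    let d := if a = 1 then 0 else m
    {![2 * p + m + a, b + d, c - 1], ![2 * p + m + a, b + d, c]})

/-- The set `B₃`. -/
def block3 (p : ℕ) : Finset (Fin 3 → ℕ) := if p = 2 then block3Two else block3Gen p

/-- The incidence structure `𝒟(3, p)` on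
`ℤ/(p² + p + 1) × ℤ/(p² - p + 1) × ℤ/(p⁴ - p² + 1)` with base block `B₁ ∪ B₂ ∪ B₃`. -/
def design3 (p : ℕ) : IncStructure (Grid (sizes3 p)) :=
  gridStructure (sizes3 p) (block1 p ∪ block2 p ∪ block3 p)

/-- The grid sizes `7, 3, 13, 241`. -/
def sizes4 : Fin 4 → ℕ := ![7, 3, 13, 241]

/-- The `17` points of the base block of `𝒟(4, 2)` whose last coordinate is `0`. -/
def block4Zero : Finset (Fin 4 → ℕ) :=
  ((Finset.Icc 0 2).image fun a => ![a, 0, 0, 0]) ∪ {![3, 1, 0, 0], ![3, 2, 0, 0]} ∪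
  (Finset.Icc 1 3 ×ˢ Finset.Icc 1 2).biUnion fun (a, b) =>
    let c := 2 * (b + 2 * (a - 1))
    {![3 + a, b, c - 1, 0], ![3 + a, b, c, 0]}

/-- The points `(a, b, c, d - 1)` and `(a, b, c, d)` with `l ≤ c ≤ u` and `d = 2 c + n - t`. -/
def block4Row (a b l u n t : ℕ) : Finset (Fin 4 → ℕ) :=
  (Finset.Icc l u).biUnion fun c =>
    let d := 2 * c + n - t
    {![a, b, c, d - 1], ![a, b, c, d]}

/-- The `240` points of the base block of `𝒟(4, 2)` whose last coordinate is not `0`. -/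
def block4Rest : Finset (Fin 4 → ℕ) :=
  block4Row 0 0 9 12 0 16 ∪ block4Row 1 0 1 4 8 0 ∪ block4Row 2 0 5 8 8 0 ∪
  block4Row 0 1 5 8 16 0 ∪ block4Row 0 1 11 12 12 0 ∪
  block4Row 1 1 3 4 32 0 ∪ block4Row 1 1 9 12 24 0 ∪
  block4Row 2 1 1 4 48 0 ∪ block4Row 2 1 7 8 44 0 ∪
  block4Row 0 2 5 10 52 0 ∪
  block4Row 1 2 1 2 72 0 ∪ block4Row 1 2 9 12 60 0 ∪
  block4Row 2 2 1 6 84 0 ∪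
  block4Row 3 0 1 12 96 0 ∪
  block4Row 3 1 3 4 116 0 ∪ block4Row 3 1 7 8 112 0 ∪ block4Row 3 1 11 12 108 0 ∪
  block4Row 3 2 1 2 132 0 ∪ block4Row 3 2 5 6 128 0 ∪ block4Row 3 2 9 10 124 0 ∪
  block4Row 4 0 9 12 128 0 ∪ block4Row 5 0 1 4 152 0 ∪ block4Row 6 0 5 8 152 0 ∪
  block4Row 4 1 5 8 160 0 ∪ block4Row 4 1 11 12 156 0 ∪
  block4Row 5 1 3 4 176 0 ∪ block4Row 5 1 9 12 168 0 ∪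
  block4Row 6 1 1 4 192 0 ∪ block4Row 6 1 7 8 188 0 ∪
  block4Row 4 2 5 10 196 0 ∪
  block4Row 5 2 1 2 216 0 ∪ block4Row 5 2 9 12 204 0 ∪
  block4Row 6 2 1 6 228 0

/-- The incidence structure `𝒟(4, 2)` on `ℤ/7 × ℤ/3 × ℤ/13 × ℤ/241`. -/
def design4 : IncStructure (Grid sizes4) :=
  gridStructure sizes4 (block4Zero ∪ block4Rest)

/-!
The full grid group `G = ∏ i, Sym (E i)` acts on ordered pairs of points with one orbit for each set
`J` of coordinates, the pairs that differ exactly in the coordinates of `J`. Blocks of `𝒟(B, G)` all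
contain the same number `n_J` of pairs of this orbit, which has `v ∏_{i ∈ J} (e i - 1)` elements, so
double counting shows that two points of the orbit lie in `b n_J / (v ∏_{i ∈ J} (e i - 1))` of the
`b` blocks. In the theorem always `k (k - 1) = v - 1`, and then `𝒟(B, G)` is a `2`-design
as soon as `n_J = ∏_{i ∈ J} (e i - 1)` for all nonempty `J`, with `lam = b / v`. By Möbius inversion
this amounts to counting, for every set `I` of coordinates, the ordered pairs of points of `B`
(equal ones included) that agree on `I`: there must be `k - 1 + ∏_{i ∉ I} e i` of them. This is
`orbitStructure_isTwoDesign`, and `gridStructure_isTwoDesign` in integer coordinates.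

The base blocks are built so that these counts can be made. A point with nonzero last coordinate is
determined by it, so such points contribute only trivial pairs when `I` contains the last coordinate
(`agreeingPairs_union`), and the count reduces to the points with last coordinate `0`. The
points with nonzero last coordinate come in couples which differ only in that coordinate. When `I`
omits the last coordinate, the count is the sum of the squares of the multiplicities with which `B`
projects to the coordinates in `I`. For `𝒟(3, p)` with `p > 2` the multiplicities are: on
the first coordinate, constant on each of five intervals (`agree_col`); on the second, `p + 1` at `0` and `p² + p + 1`
elsewhere (`agree_row`); on the first two together, `1` on `B₁ ∪ B₂` and `2` on `B₃`
(`agree_position`). The number `r` enters only in the first of these, and its value is what makes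
that condition hold. For `𝒟(3, 2)` and `𝒟(4, 2)` the counts are finite computations; for the latter
the points with nonzero last coordinate are grouped into `33` rows, and pairs are counted by rows.

Block-transitivity and grid-imprimitivity are witnessed by `G` itself, and `𝒟(3, p)` and `𝒟(3, q)`
are told apart by their numbers of points.
-/

/-! ### Orbit structures of the grid group -/

lemma image_mem_orbitStructure_blocks {P : Type*} {B : Set P} {H : Subgroup (Equiv.Perm P)}
    {h : Equiv.Perm P} (hh : h ∈ H) {b : Set P} :
    h '' b ∈ (orbitStructure B H).blocks ↔ b ∈ (orbitStructure B H).blocks := by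
  constructor
  · rintro ⟨k, hk, hb⟩
    refine ⟨h⁻¹ * k, H.mul_mem (H.inv_mem hh) hk, ?_⟩
    rw [Equiv.Perm.coe_mul, Set.image_comp, ← hb, ← Set.image_comp, ← Equiv.Perm.coe_mul]
    simp
  · rintro ⟨k, hk, rfl⟩
    exact ⟨h * k, H.mul_mem hh hk, by rw [Equiv.Perm.coe_mul, Set.image_comp]⟩

lemma orbitStructure_isAutGroup {P : Type*} (B : Set P) (H : Subgroup (Equiv.Perm P)) :
    (orbitStructure B H).IsAutGroup H :=
  fun _ hh _ => image_mem_orbitStructure_blocks hh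

lemma orbitStructure_isTransitiveOnBlocks {P : Type*} (B : Set P) (H : Subgroup (Equiv.Perm P)) :
    (orbitStructure B H).IsTransitiveOnBlocks H := by
  rintro b ⟨h, hh, rfl⟩ b' ⟨h', hh', rfl⟩
  refine ⟨h' * h⁻¹, H.mul_mem hh' (H.inv_mem hh), ?_⟩
  rw [← Set.image_comp, ← Equiv.Perm.coe_mul]
  simp

section ProductAction

variable {ι : Type*} [Fintype ι] {E : ι → Type*} [∀ i, DecidableEq (E i)]

/-- The set of coordinates in which two points of a grid differ. -/
def diffSet (x y : ∀ i, E i) : Finset ι := {i | x i ≠ y i}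

lemma diffSet_eq_empty_iff {x y : ∀ i, E i} : diffSet x y = ∅ ↔ x = y := by
  simp [diffSet, Finset.filter_eq_empty_iff, funext_iff]

lemma diffSet_apply {h : Equiv.Perm (∀ i, E i)} (hh : h ∈ gridGroup E) (x y : ∀ i, E i) :
    diffSet (h x) (h y) = diffSet x y := by
  obtain ⟨g, hg⟩ := hh
  ext i
  simp [diffSet, hg]

/-- The orbits of the grid group on ordered pairs of points are the sets of pairs with a given
difference set. -/
lemma exists_mem_gridGroup_of_diffSet_eq {x y x' y' : ∀ i, E i}
    (h : diffSet x y = diffSet x' y') : ∃ g ∈ gridGroup E, g x = x' ∧ g y = y' := by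
  have key : ∀ i, ∃ g : Equiv.Perm (E i), g (x i) = x' i ∧ g (y i) = y' i := by
    intro i
    have hi : x i ≠ y i ↔ x' i ≠ y' i := by
      have := Finset.ext_iff.mp h i
      simpa [diffSet] using this
    by_cases hxy : x i = y i
    · have hxy' : x' i = y' i := by
        by_contra hne
        exact (hi.mpr hne) hxy
      exact ⟨Equiv.swap (x i) (x' i), by simp, by rw [← hxy, ← hxy']; simp⟩
    · refine ⟨Equiv.swap (Equiv.swap (x i) (x' i) (y i)) (y' i) * Equiv.swap (x i) (x' i), ?_, ?_⟩
      · have h1 : x' i ≠ Equiv.swap (x i) (x' i) (y i) := by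
          intro h1
          have h2 : Equiv.swap (x i) (x' i) (x i) = Equiv.swap (x i) (x' i) (y i) := by simpa
          exact hxy ((Equiv.swap (x i) (x' i)).injective h2)
        simp only [Equiv.Perm.mul_apply, Equiv.swap_apply_left]
        exact Equiv.swap_apply_of_ne_of_ne h1 (hi.mp hxy)
      · simp
  choose g hgx hgy using key
  exact ⟨Equiv.piCongrRight g, ⟨g, fun _ _ => rfl⟩, funext hgx, funext hgy⟩

variable [DecidableEq ι] [∀ i, Fintype (E i)]

/-- The ordered pairs of points of the grid whose difference set is exactly `J`. -/
def pairsOfType (E : ι → Type*) [∀ i, Fintype (E i)] [∀ i, DecidableEq (E i)] (J : Finset ι) :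
    Finset ((∀ i, E i) × (∀ i, E i)) := {q | diffSet q.1 q.2 = J}

lemma card_pairsOfType (J : Finset ι) :
    (pairsOfType E J).card = (∏ i, Fintype.card (E i)) * ∏ i ∈ J, (Fintype.card (E i) - 1) := by
  have h1 : ∀ x : ∀ i, E i, ({y | diffSet x y = J} : Finset (∀ i, E i)).card
      = ∏ i ∈ J, (Fintype.card (E i) - 1) := by
    intro x
    have : ({y | diffSet x y = J} : Finset (∀ i, E i))
        = Fintype.piFinset fun i => if i ∈ J then Finset.univ.erase (x i) else {x i} := by
      ext y
      simp only [Finset.mem_filter, Finset.mem_univ, true_and, Fintype.mem_piFinset, diffSet,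
        Finset.ext_iff]
      refine forall_congr' fun i => ?_
      by_cases hi : i ∈ J <;> simp [hi, eq_comm]
    rw [this, Fintype.card_piFinset, ← Finset.prod_subset (Finset.subset_univ J)]
    · refine Finset.prod_congr rfl fun i hi => ?_
      simp [hi, Finset.card_erase_of_mem]
    · intro i _ hi
      simp [hi]
  have h2 : (pairsOfType E J).card
      = ∑ x : ∀ i, E i, ({y | diffSet x y = J} : Finset (∀ i, E i)).card := by
    simp only [pairsOfType, Finset.card_filter, ← Finset.univ_product_univ, Finset.sum_product]
  rw [h2]
  simp [h1, Fintype.card_pi]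

/-- Möbius inversion: the numbers of pairs agreeing on each set `I` of coordinates
determine the numbers of pairs with each difference set. -/
lemma card_filter_diffSet_eq (B : Finset (∀ i, E i)) (hE : ∀ i, 1 ≤ Fintype.card (E i))
    (hB : ∀ I : Finset ι, ((B ×ˢ B).filter fun q => ∀ i ∈ I, q.1 i = q.2 i).card + 1
      = B.card + ∏ i ∈ Iᶜ, Fintype.card (E i)) (J : Finset ι) (hJ : J.Nonempty) :
    ((B ×ˢ B).filter fun q => diffSet q.1 q.2 = J).card
      = ∏ i ∈ J, (Fintype.card (E i) - 1) := by
  induction J using Finset.strongInduction with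
  | H J ih =>
    have hsum : ((B ×ˢ B).filter fun q => ∀ i ∈ Jᶜ, q.1 i = q.2 i).card
        = ∑ K ∈ J.powerset, ((B ×ˢ B).filter fun q => diffSet q.1 q.2 = K).card := by
      rw [Finset.card_eq_sum_card_fiberwise (f := fun q => diffSet q.1 q.2) (t := J.powerset)]
      · refine Finset.sum_congr rfl fun K hK => ?_
        rw [Finset.mem_powerset] at hK
        rw [Finset.filter_filter]
        congr 1
        refine Finset.filter_congr fun q _ => ⟨fun h => h.2, fun h => ⟨fun i hi => ?_, h⟩⟩
        by_contra hne
        have : i ∈ diffSet q.1 q.2 := by simp [diffSet, hne]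
        rw [h] at this
        exact Finset.mem_compl.mp hi (hK this)
      · intro q hq
        simp only [Finset.coe_filter, Set.mem_ofPred_eq] at hq
        simp only [Finset.coe_powerset, Set.mem_preimage, Set.mem_powerset_iff, Finset.coe_subset]
        intro i hi
        by_contra hn
        simp [diffSet] at hi
        exact hi (hq.2 i (by simpa using hn))
    have hprod : ∏ i ∈ J, Fintype.card (E i)
        = ∑ K ∈ J.powerset, ∏ i ∈ K, (Fintype.card (E i) - 1) := by
      rw [← Finset.prod_add_one]
      exact Finset.prod_congr rfl fun i _ => (Nat.sub_add_cancel (hE i)).symm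
    have h0 : ((B ×ˢ B).filter fun q => diffSet q.1 q.2 = ∅).card = B.card := by
      have : ((B ×ˢ B).filter fun q => diffSet q.1 q.2 = ∅) = B.diag := by
        ext q
        simp only [diffSet_eq_empty_iff, Finset.mem_filter, Finset.mem_product, Finset.mem_diag]
        constructor
        · rintro ⟨⟨h1, _⟩, h2⟩
          exact ⟨h1, h2⟩
        · rintro ⟨h1, h2⟩
          exact ⟨⟨h1, h2 ▸ h1⟩, h2⟩
      rw [this, Finset.diag_card]
    -- Isolate the terms for `J` and `∅`; the remaining ones agree by induction.
    have hmain := hB Jᶜ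
    rw [compl_compl, hsum, hprod] at hmain
    have hJp : J ∈ J.powerset := Finset.mem_powerset_self J
    have h0p : ∅ ∈ J.powerset.erase J :=
      Finset.mem_erase.mpr ⟨hJ.ne_empty.symm, Finset.empty_mem_powerset J⟩
    rw [← Finset.add_sum_erase _ _ hJp, ← Finset.add_sum_erase _ _ h0p,
      ← Finset.add_sum_erase _ _ hJp, ← Finset.add_sum_erase _ _ h0p, h0] at hmain
    have hrest : ∑ K ∈ (J.powerset.erase J).erase ∅,
          ((B ×ˢ B).filter fun q => diffSet q.1 q.2 = K).card
        = ∑ K ∈ (J.powerset.erase J).erase ∅, ∏ i ∈ K, (Fintype.card (E i) - 1) := by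
      refine Finset.sum_congr rfl fun K hK => ?_
      simp only [Finset.mem_erase, Finset.mem_powerset] at hK
      exact ih K (Finset.ssubset_iff_subset_ne.mpr ⟨hK.2.2, hK.2.1⟩)
        (Finset.nonempty_iff_ne_empty.mpr hK.1)
    rw [hrest, Finset.prod_empty] at hmain
    omega

/-- The number of blocks through two distinct points is constant on each orbit of the grid group on
pairs. Double counting the pairs of one orbit in all blocks, the number is `b / v`
for every orbit, where `b` is the number of blocks and `v` the number of points. -/
lemma card_blocks_through_mul (B : Finset (∀ i, E i)) (hE : ∀ i, 1 ≤ Fintype.card (E i))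
    (hB : ∀ I : Finset ι, ((B ×ˢ B).filter fun q => ∀ i ∈ I, q.1 i = q.2 i).card + 1
      = B.card + ∏ i ∈ Iᶜ, Fintype.card (E i)) (x y : ∀ i, E i) (hxy : x ≠ y) :
    {b ∈ (orbitStructure (B : Set (∀ i, E i)) (gridGroup E)).blocks | x ∈ b ∧ y ∈ b}.ncard
        * ∏ i, Fintype.card (E i)
      = (orbitStructure (B : Set (∀ i, E i)) (gridGroup E)).blocks.ncard := by
  classical
  set D := orbitStructure (B : Set (∀ i, E i)) (gridGroup E) with hD
  set N : (∀ i, E i) → (∀ i, E i) → ℕ := fun x y => {b ∈ D.blocks | x ∈ b ∧ y ∈ b}.ncard with hN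
  set J := diffSet x y with hJ
  have hJne : J.Nonempty := by
    rw [Finset.nonempty_iff_ne_empty, hJ, Ne, diffSet_eq_empty_iff]
    exact hxy
  have hconst : ∀ q ∈ pairsOfType E J, N q.1 q.2 = N x y := by
    intro q hq
    simp only [pairsOfType, Finset.mem_filter, Finset.mem_univ, true_and] at hq
    obtain ⟨g, hg, hgx, hgy⟩ := exists_mem_gridGroup_of_diffSet_eq hq
    have himg : {b ∈ D.blocks | x ∈ b ∧ y ∈ b}
        = (fun b => g '' b) '' {b ∈ D.blocks | q.1 ∈ b ∧ q.2 ∈ b} := by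
      ext b
      constructor
      · rintro ⟨hb, hxb, hyb⟩
        have hgb : g '' (g ⁻¹' b) = b := Set.image_preimage_eq b g.surjective
        refine ⟨g ⁻¹' b, ⟨?_, ?_, ?_⟩, hgb⟩
        · rw [← image_mem_orbitStructure_blocks hg, hgb]
          exact hb
        · simpa [hgx] using hxb
        · simpa [hgy] using hyb
      · rintro ⟨b, ⟨hb, hxb, hyb⟩, rfl⟩
        exact ⟨(image_mem_orbitStructure_blocks hg).mpr hb, ⟨_, hxb, hgx⟩, ⟨_, hyb, hgy⟩⟩
    simp only [hN]
    rw [himg, Set.ncard_image_of_injective _ (Set.image_injective.mpr g.injective)]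
  have hfin : D.blocks.Finite := Set.toFinite _
  have hNcard : ∀ q : (∀ i, E i) × (∀ i, E i),
      N q.1 q.2 = ∑ b ∈ hfin.toFinset, if q.1 ∈ b ∧ q.2 ∈ b then 1 else 0 := by
    intro q
    rw [← Finset.card_filter, ← Set.ncard_coe_finset]
    simp [hN]
  have hblock : ∀ b ∈ hfin.toFinset,
      (∑ q ∈ pairsOfType E J, if q.1 ∈ b ∧ q.2 ∈ b then 1 else 0)
        = ∏ i ∈ J, (Fintype.card (E i) - 1) := by
    intro b hb
    rw [Set.Finite.mem_toFinset] at hb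
    obtain ⟨h, hh, rfl⟩ := hb
    rw [← card_filter_diffSet_eq B hE hB J hJne, ← Finset.card_filter]
    symm
    refine Finset.card_bij (fun q _ => (h q.1, h q.2)) ?_ ?_ ?_
    · intro q hq
      simp only [Finset.mem_filter, Finset.mem_product] at hq
      simp [pairsOfType, diffSet_apply hh, hq]
    · intro q _ q' _ heq
      simp only [Prod.mk.injEq, EmbeddingLike.apply_eq_iff_eq] at heq
      exact Prod.ext heq.1 heq.2
    · rintro ⟨u, w⟩ hq
      simp only [pairsOfType, Finset.mem_filter, Finset.mem_univ, true_and] at hq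
      obtain ⟨hd, ⟨u', hu', rfl⟩, ⟨w', hw', rfl⟩⟩ := hq
      rw [diffSet_apply hh] at hd
      refine ⟨(u', w'), ?_, rfl⟩
      simp only [Finset.mem_filter, Finset.mem_product]
      exact ⟨⟨hu', hw'⟩, hd⟩
  have hdouble : N x y * (pairsOfType E J).card
      = D.blocks.ncard * ∏ i ∈ J, (Fintype.card (E i) - 1) := by
    calc N x y * (pairsOfType E J).card = ∑ q ∈ pairsOfType E J, N q.1 q.2 := by
          rw [Finset.sum_congr rfl hconst]
          simp [mul_comm]
      _ = ∑ b ∈ hfin.toFinset, ∑ q ∈ pairsOfType E J, if q.1 ∈ b ∧ q.2 ∈ b then 1 else 0 := by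
          simp only [hNcard]
          exact Finset.sum_comm
      _ = _ := by
          rw [Finset.sum_congr rfl hblock, Finset.sum_const, smul_eq_mul,
            Set.ncard_eq_toFinset_card _ hfin]
  have hpos : 0 < ∏ i ∈ J, (Fintype.card (E i) - 1) := by
    refine Finset.prod_pos fun i hi => ?_
    have hne : x i ≠ y i := by simpa [hJ, diffSet] using hi
    have := Fintype.one_lt_card_iff.mpr ⟨_, _, hne⟩
    omega
  rw [card_pairsOfType, ← mul_assoc] at hdouble
  exact Nat.eq_of_mul_eq_mul_right hpos hdouble

/-- The counting criterion: if, for every set `I` of coordinates, the number of ordered pairs of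
points of `B` agreeing on `I` is `k - 1 + ∏ i ∉ I, e i`, then `𝒟(B, G)` is a `2`-design. -/
theorem orbitStructure_isTwoDesign (B : Finset (∀ i, E i)) (hE : ∀ i, 1 ≤ Fintype.card (E i))
    (hB : ∀ I : Finset ι, ((B ×ˢ B).filter fun q => ∀ i ∈ I, q.1 i = q.2 i).card + 1
      = B.card + ∏ i ∈ Iᶜ, Fintype.card (E i)) (hk : 2 ≤ B.card)
    (hv : B.card < ∏ i, Fintype.card (E i)) :
    ∃ lam, (orbitStructure (B : Set (∀ i, E i)) (gridGroup E)).IsTwoDesign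
      (∏ i, Fintype.card (E i)) B.card lam := by
  set D := orbitStructure (B : Set (∀ i, E i)) (gridGroup E) with hD
  have hmul := card_blocks_through_mul B hE hB
  rw [← hD] at hmul
  have hvpos : 0 < ∏ i, Fintype.card (E i) := by omega
  have hbpos : 0 < D.blocks.ncard :=
    (Set.ncard_pos (Set.toFinite _)).mpr ⟨B, 1, Subgroup.one_mem _, by simp⟩
  obtain ⟨x, y, hxy⟩ : ∃ x y : ∀ i, E i, x ≠ y := by
    obtain ⟨x, _, y, _, hxy⟩ := Finset.one_lt_card.mp (show 1 < B.card by omega)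
    exact ⟨x, y, hxy⟩
  refine ⟨{b ∈ D.blocks | x ∈ b ∧ y ∈ b}.ncard, ⟨?_, hk, hv, ?_, ?_, ?_⟩⟩
  · rw [Nat.card_eq_fintype_card, Fintype.card_pi]
  · refine Nat.pos_of_ne_zero fun h0 => ?_
    have := hmul x y hxy
    rw [h0] at this
    omega
  · rintro b ⟨h, _, rfl⟩
    rw [Set.ncard_image_of_injective _ h.injective, Set.ncard_coe_finset]
  · intro x' y' hxy'
    exact Nat.eq_of_mul_eq_mul_right hvpos ((hmul x' y' hxy').trans (hmul x y hxy).symm)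

end ProductAction

/-! ### Base blocks in integer coordinates -/

/-- The number of ordered pairs of elements of `B` that agree on the coordinates in `I`. -/
def agreeingPairs {s : ℕ} (B : Finset (Fin s → ℕ)) (I : Finset (Fin s)) : ℕ :=
  ∑ u ∈ B, ∑ w ∈ B, if ∀ i ∈ I, u i = w i then 1 else 0

/-- The counting criterion for a base block given by the integer coordinates of its points. -/
theorem gridStructure_isTwoDesign {s : ℕ} (e : Fin s → ℕ) (B : Finset (Fin s → ℕ))
    (hlt : ∀ u ∈ B, ∀ i, u i < e i)
    (hB : ∀ I : Finset (Fin s), agreeingPairs B I + 1 = B.card + ∏ i, if i ∈ I then 1 else e i)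
    (hk : 2 ≤ B.card) (hv : B.card < ∏ i, e i) :
    ∃ lam, (gridStructure e B).IsTwoDesign (∏ i, e i) B.card lam := by
  have hne : ∀ i, NeZero (e i) := fun i => ⟨fun h0 => by
    rw [Finset.prod_eq_zero (Finset.mem_univ i) h0] at hv
    omega⟩
  have hcast : ∀ u ∈ B, ∀ w ∈ B, ∀ i, gridPoint e u i = gridPoint e w i ↔ u i = w i := by
    intro u hu w hw i
    constructor
    · intro h
      have := congrArg ZMod.val h
      simpa [gridPoint, ZMod.val_natCast, Nat.mod_eq_of_lt (hlt u hu i),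
        Nat.mod_eq_of_lt (hlt w hw i)] using this
    · intro h
      simp [gridPoint, h]
  have hinj : Set.InjOn (gridPoint e) B := fun u hu w hw h =>
    funext fun i => (hcast u hu w hw i).mp (congrFun h i)
  have hcard : (B.image (gridPoint e)).card = B.card := Finset.card_image_of_injOn hinj
  have key := orbitStructure_isTwoDesign (E := fun i => ZMod (e i)) (B.image (gridPoint e))
    (fun i => by rw [ZMod.card]; exact Nat.pos_of_neZero _) (fun I => ?_)
    (by rw [hcard]; exact hk) (by rw [hcard]; simpa only [ZMod.card] using hv)
  · simp only [hcard, ZMod.card, Finset.coe_image] at key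
    exact key
  · rw [hcard]
    simp only [ZMod.card]
    have hp : ∏ i ∈ Iᶜ, e i = ∏ i, if i ∈ I then 1 else e i := by
      rw [Finset.prod_ite]
      simp only [Finset.prod_const_one, one_mul]
      exact Finset.prod_congr (by ext; simp) fun _ _ => rfl
    rw [hp, ← hB I, Finset.card_filter, Finset.sum_product, Finset.sum_image hinj, agreeingPairs]
    congr 1
    refine Finset.sum_congr rfl fun u hu => ?_
    rw [Finset.sum_image hinj]
    refine Finset.sum_congr rfl fun w hw => ?_
    simp only [hcast u hu w hw]

theorem gridStructure_isBlockTransitiveGridImprimitive {s : ℕ} (hs : 2 ≤ s) (e : Fin s → ℕ)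
    (he : ∀ i, 1 < e i) (B : Finset (Fin s → ℕ)) :
    (gridStructure e B).IsBlockTransitiveGridImprimitive s := by
  refine ⟨gridGroup fun i => ZMod (e i), orbitStructure_isAutGroup _ _,
    orbitStructure_isTransitiveOnBlocks _ _, hs, e, he, ?_⟩
  have hne : ∀ i, NeZero (e i) := fun i => ⟨by have := he i; omega⟩
  let f : ∀ i, ZMod (e i) ≃ Fin (e i) := fun i => (ZMod.finEquiv (e i)).symm.toEquiv
  refine ⟨Equiv.piCongrRight f, ?_⟩
  rintro h ⟨g, hg⟩
  refine ⟨fun i => (f i).permCongr (g i), fun x i => ?_⟩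
  simp [Equiv.permCongr_apply, hg]

lemma IncStructure.Isomorphic.natCard_eq {P Q : Type*} {D : IncStructure P} {D' : IncStructure Q}
    (h : D.Isomorphic D') : Nat.card P = Nat.card Q :=
  let ⟨φ, _⟩ := h
  Nat.card_congr φ

/-! ### Counting pairs that agree on a set of coordinates -/

section AgreeingPairs

variable {s : ℕ}

/-- If the `j`-th coordinate separates the points of `Y` from each other and from those of `X`,
and `j ∈ I`, then the points of `Y` contribute only the trivial pairs. -/
lemma agreeingPairs_union {X Y : Finset (Fin s → ℕ)} {I : Finset (Fin s)} {j : Fin s} (hj : j ∈ I)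
    (hXY : ∀ u ∈ X, ∀ w ∈ Y, u j ≠ w j) (hY : ∀ u ∈ Y, ∀ w ∈ Y, u j = w j → u = w) :
    agreeingPairs (X ∪ Y) I = agreeingPairs X I + Y.card := by
  have hdisj : Disjoint X Y := Finset.disjoint_left.mpr fun u hu hu' => hXY u hu u hu' rfl
  have h1 : ∀ u ∈ X, ∑ w ∈ Y, (if ∀ i ∈ I, u i = w i then 1 else 0) = 0 := fun u hu =>
    Finset.sum_eq_zero fun w hw => if_neg fun h => hXY u hu w hw (h j hj)
  have h2 : ∀ u ∈ Y, ∑ w ∈ X, (if ∀ i ∈ I, u i = w i then 1 else 0) = 0 := fun u hu =>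
    Finset.sum_eq_zero fun w hw => if_neg fun h => hXY w hw u hu (h j hj).symm
  have h3 : ∀ u ∈ Y, ∑ w ∈ Y, (if ∀ i ∈ I, u i = w i then 1 else 0) = 1 := by
    intro u hu
    rw [Finset.sum_eq_single u]
    · simp
    · exact fun w hw hne => if_neg fun h => hne (hY u hu w hw (h j hj)).symm
    · exact fun h => absurd hu h
  simp only [agreeingPairs, Finset.sum_union hdisj, Finset.sum_add_distrib]
  rw [Finset.sum_congr rfl h1, Finset.sum_congr rfl h2, Finset.sum_congr rfl h3]
  simp

lemma agreeingPairs_empty (B : Finset (Fin s → ℕ)) : agreeingPairs B ∅ = B.card * B.card := by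
  simp [agreeingPairs]

/-- If the sums over `B` of functions of the coordinates in `I` are given by the formula `Φ`, and
`W` counts the points of `B` with given coordinates in `I`, then `Φ W` is the number of pairs
agreeing on `I`. -/
lemma agreeingPairs_eq_of_sum {α : Type*} [DecidableEq α] {B : Finset (Fin s → ℕ)}
    {I : Finset (Fin s)} (π : (Fin s → ℕ) → α) (Φ : (α → ℕ) → ℕ) (W : α → ℕ)
    (hπ : ∀ u w : Fin s → ℕ, (∀ i ∈ I, u i = w i) ↔ π u = π w)
    (hΦ : ∀ f : α → ℕ, ∑ u ∈ B, f (π u) = Φ f)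
    (hW : ∀ x, (Φ fun y => if x = y then 1 else 0) = W x) :
    agreeingPairs B I = Φ W := by
  rw [← hΦ, agreeingPairs]
  refine Finset.sum_congr rfl fun u _ => ?_
  rw [← hW, ← hΦ]
  exact Finset.sum_congr rfl fun w _ => by simp only [hπ u w]

end AgreeingPairs

lemma sum_Icc_ite_eq_add (n k x : ℕ) :
    ∑ a ∈ Finset.Icc 1 n, (if x = k + a then 1 else 0) = if k < x ∧ x ≤ k + n then 1 else 0 := by
  by_cases h : k < x ∧ x ≤ k + n
  · rw [if_pos h, Finset.sum_eq_single (x - k)]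
    · rw [if_pos (by omega)]
    · intro a _ hne
      exact if_neg (by omega)
    · intro hn
      exact absurd (Finset.mem_Icc.mpr (by omega)) hn
  · rw [if_neg h]
    refine Finset.sum_eq_zero fun a ha => if_neg ?_
    rw [Finset.mem_Icc] at ha
    omega

lemma sum_Icc_ite_eq (n x : ℕ) :
    ∑ a ∈ Finset.Icc 1 n, (if x = a then 1 else 0) = if 0 < x ∧ x ≤ n then 1 else 0 := by
  simpa using sum_Icc_ite_eq_add n 0 x

lemma sum_Icc_add (f : ℕ → ℕ) (k n : ℕ) :
    ∑ a ∈ Finset.Icc 1 (k + n), f a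
      = ∑ a ∈ Finset.Icc 1 k, f a + ∑ a ∈ Finset.Icc 1 n, f (k + a) := by
  induction n with
  | zero => simp
  | succ n ih => rw [← add_assoc, Finset.sum_Icc_succ_top (by omega), ih,
      Finset.sum_Icc_succ_top (by omega)]; ring_nf

lemma sum_Icc_two_mul (f : ℕ → ℕ) (n : ℕ) :
    ∑ a ∈ Finset.Icc 1 n, (f (2 * a - 1) + f (2 * a)) = ∑ a ∈ Finset.Icc 1 (2 * n), f a := by
  induction n with
  | zero => simp
  | succ n ih =>
    rw [Finset.sum_Icc_succ_top (by omega), ih, show 2 * (n + 1) = 2 * n + 1 + 1 by ring,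
      Finset.sum_Icc_succ_top (by omega), Finset.sum_Icc_succ_top (by omega)]
    simp [add_assoc]

lemma sum_Icc_zero (f : ℕ → ℕ) (n : ℕ) :
    ∑ a ∈ Finset.Icc 0 n, f a = f 0 + ∑ a ∈ Finset.Icc 1 n, f a := by
  induction n with
  | zero => simp
  | succ n ih => rw [Finset.sum_Icc_succ_top (by omega), ih, Finset.sum_Icc_succ_top (by omega),
      add_assoc]

/-! ### Couples of points indexed by a rectangle -/

/-- The points `(X a b, Y a b, c - 1)` and `(X a b, Y a b, c)` for `1 ≤ a ≤ n`, `1 ≤ b ≤ n'`, where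
`c = C + 2 (a + (b - 1) n)` runs through `C + 2, C + 4, …, C + 2 n n'`. -/
def pairedPiece (n n' C : ℕ) (X Y : ℕ → ℕ → ℕ) : Finset (Fin 3 → ℕ) :=
  (Finset.Icc 1 n ×ˢ Finset.Icc 1 n').biUnion fun q =>
    {![X q.1 q.2, Y q.1 q.2, C + 2 * (q.1 + (q.2 - 1) * n) - 1],
      ![X q.1 q.2, Y q.1 q.2, C + 2 * (q.1 + (q.2 - 1) * n)]}

section PairedPiece

variable {n n' C : ℕ} {X Y : ℕ → ℕ → ℕ}

lemma mem_pairedPiece {u : Fin 3 → ℕ} : u ∈ pairedPiece n n' C X Y ↔ ∃ a b, 1 ≤ a ∧ a ≤ n ∧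
    1 ≤ b ∧ b ≤ n' ∧ u 0 = X a b ∧ u 1 = Y a b ∧
    (u 2 + 1 = C + 2 * (a + (b - 1) * n) ∨ u 2 = C + 2 * (a + (b - 1) * n)) := by
  simp only [pairedPiece, Finset.mem_biUnion, Finset.mem_product, Finset.mem_Icc,
    Finset.mem_insert, Finset.mem_singleton, Prod.exists]
  refine exists_congr fun a => exists_congr fun b => ?_
  have hvec : ∀ x y z : ℕ, u = ![x, y, z] ↔ u 0 = x ∧ u 1 = y ∧ u 2 = z := by
    intro x y z
    simp [funext_iff, Fin.forall_fin_succ]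
  rw [hvec, hvec]
  generalize (b - 1) * n = t
  omega

/-- The last coordinate determines the index `(a, b)`. -/
lemma index_injective {a b a' b' : ℕ} (ha : 1 ≤ a) (ha' : a ≤ n) (hb : 1 ≤ b) (ha2 : 1 ≤ a')
    (ha2' : a' ≤ n) (hb2 : 1 ≤ b') (h : a + (b - 1) * n = a' + (b' - 1) * n) :
    a = a' ∧ b = b' := by
  have hlt : b - 1 = b' - 1 := by
    rcases lt_trichotomy (b - 1) (b' - 1) with hlt | heq | hlt
    · have := Nat.mul_le_mul_right n (show b - 1 + 1 ≤ b' - 1 from hlt)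
      rw [add_mul] at this
      omega
    · exact heq
    · have := Nat.mul_le_mul_right n (show b' - 1 + 1 ≤ b - 1 from hlt)
      rw [add_mul] at this
      omega
  rw [hlt] at h
  omega

lemma pairedPiece_last_mem {u : Fin 3 → ℕ} (hu : u ∈ pairedPiece n n' C X Y) :
    C < u 2 ∧ u 2 ≤ C + 2 * (n * n') := by
  obtain ⟨a, b, ha, ha', hb, hb', -, -, h⟩ := mem_pairedPiece.mp hu
  have h1 := Nat.mul_le_mul_right n (show b - 1 + 1 ≤ n' by omega)
  rw [add_mul, mul_comm n' n] at h1
  generalize (b - 1) * n = t at *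
  omega

lemma pairedPiece_last_injective {u w : Fin 3 → ℕ} (hu : u ∈ pairedPiece n n' C X Y)
    (hw : w ∈ pairedPiece n n' C X Y) (h : u 2 = w 2) : u = w := by
  obtain ⟨a, b, ha, ha', hb, hb', hu0, hu1, hu2⟩ := mem_pairedPiece.mp hu
  obtain ⟨a', b', ga, ga', gb, gb', hw0, hw1, hw2⟩ := mem_pairedPiece.mp hw
  obtain ⟨rfl, rfl⟩ := index_injective ha ha' hb ga ga' gb (by
    generalize (b - 1) * n = t at *
    generalize (b' - 1) * n = t' at *
    omega)
  funext i
  fin_cases i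
  · exact hu0.trans hw0.symm
  · exact hu1.trans hw1.symm
  · exact h

lemma sum_pairedPiece (f : ℕ → ℕ → ℕ) : ∑ u ∈ pairedPiece n n' C X Y, f (u 0) (u 1)
    = 2 * ∑ b ∈ Finset.Icc 1 n', ∑ a ∈ Finset.Icc 1 n, f (X a b) (Y a b) := by
  rw [pairedPiece, Finset.sum_biUnion, Finset.sum_product_right, Finset.mul_sum]
  · refine Finset.sum_congr rfl fun b hb => ?_
    rw [Finset.mul_sum]
    refine Finset.sum_congr rfl fun a ha => ?_
    rw [Finset.mem_Icc] at ha hb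
    rw [Finset.sum_pair]
    · simp [two_mul]
    · intro h
      have := congrFun h 2
      simp only [Matrix.cons_val] at this
      omega
  · rintro ⟨a, b⟩ hq ⟨a', b'⟩ hq' hne
    simp only [Finset.coe_product, Finset.coe_Icc, Set.mem_prod, Set.mem_Icc] at hq hq'
    refine Finset.disjoint_left.mpr fun u hu hu' => hne ?_
    simp only [Finset.mem_insert, Finset.mem_singleton] at hu hu'
    have h1 : u 2 + 1 = C + 2 * (a + (b - 1) * n) ∨ u 2 = C + 2 * (a + (b - 1) * n) := by
      rcases hu with h | h <;> have := congrFun h 2 <;>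
        simp only [Matrix.cons_val] at this <;> omega
    have h2 : u 2 + 1 = C + 2 * (a' + (b' - 1) * n) ∨ u 2 = C + 2 * (a' + (b' - 1) * n) := by
      rcases hu' with h | h <;> have := congrFun h 2 <;>
        simp only [Matrix.cons_val] at this <;> omega
    obtain ⟨rfl, rfl⟩ := index_injective hq.1.1 hq.1.2 hq.2.1 hq'.1.1 hq'.1.2 hq'.2.1 (by
      generalize (b - 1) * n = t at *
      generalize (b' - 1) * n = t' at *
      omega)
    rfl

end PairedPiece

/-! ### The base block of the three-dimensional structures -/

/-- The part `B₁ ∪ B₂` of the base block of `𝒟(3, p)`, with `m = (p² - p) / 2`. -/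
def basePart (p m : ℕ) : Finset (Fin 3 → ℕ) :=
  ((Finset.Icc 0 p).image fun a => ![a, 0, 0]) ∪
    (Finset.Icc 1 m).biUnion fun a => {![p + a, 2 * a - 1, 0], ![p + a, 2 * a, 0]}

/-- The first constituent of `B₃`: the columns `1, …, p` in the rows `1, …, r`. -/
def topPiece1 (p r : ℕ) : Finset (Fin 3 → ℕ) :=
  pairedPiece p r 0 (fun a _ => a) (fun _ b => b)

/-- The second constituent of `B₃`: in the columns `p + 1, …, p + m` each index pair is placed so as
to avoid the positions of `B₂`. -/
def topPiece2 (p m r : ℕ) : Finset (Fin 3 → ℕ) :=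
  pairedPiece m m (2 * p * r) (fun a _ => p + a)
    (fun a b => b + if b = 2 * a - 1 ∨ b = 2 * a then m else 0)

/-- The third constituent of `B₃`: the columns `p + m + 1, …, 2 p + m` in the rows
`r + 1, …, 2 m`. -/
def topPiece3 (p m r : ℕ) : Finset (Fin 3 → ℕ) :=
  pairedPiece p (2 * m - r) (2 * p * r + 2 * m ^ 2) (fun a _ => p + m + a) (fun _ b => r + b)

/-- The fourth constituent of `B₃`, in the columns `2 p + m + 1, …, 2 p + 2 m`: in rows `1, …, m` it
has the first of these columns, in rows `m + 1, …, 2 m` the others. -/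
def topPiece4 (p m : ℕ) : Finset (Fin 3 → ℕ) :=
  pairedPiece m m (2 * m ^ 2 + 4 * p * m) (fun a _ => 2 * p + m + a)
    (fun a b => b + if a = 1 then 0 else m)

/-- The part `B₃` of the base block of `𝒟(3, p)` for `p > 2`. -/
def topPart (p m r : ℕ) : Finset (Fin 3 → ℕ) :=
  topPiece1 p r ∪ topPiece2 p m r ∪ topPiece3 p m r ∪ topPiece4 p m

lemma block3Gen_eq (p : ℕ) : block3Gen p = topPart p ((p ^ 2 - p) / 2)
    (if p % 2 = 1 then (p ^ 2 - 1) / 2 else (p ^ 2 - 2 * p) / 2) := by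
  simp only [block3Gen, topPart, topPiece1, topPiece2, topPiece3, topPiece4, pairedPiece, zero_add]

lemma mem_basePart {p m : ℕ} {u : Fin 3 → ℕ} : u ∈ basePart p m ↔
    u 2 = 0 ∧ ((u 0 ≤ p ∧ u 1 = 0) ∨
      (p < u 0 ∧ u 0 ≤ p + m ∧ (u 1 + 1 = 2 * (u 0 - p) ∨ u 1 = 2 * (u 0 - p)))) := by
  have hvec : ∀ x y z : ℕ, u = ![x, y, z] ↔ u 0 = x ∧ u 1 = y ∧ u 2 = z := by
    intro x y z
    simp [funext_iff, Fin.forall_fin_succ]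
  simp only [basePart, Finset.mem_union, Finset.mem_image, Finset.mem_biUnion, Finset.mem_Icc,
    Finset.mem_insert, Finset.mem_singleton, eq_comm (b := u), hvec]
  constructor
  · rintro (⟨a, h1, h2⟩ | ⟨a, h1, h2⟩) <;> omega
  · rintro ⟨h0, h | h⟩
    · exact Or.inl ⟨u 0, by omega⟩
    · exact Or.inr ⟨u 0 - p, by omega⟩

lemma sum_basePart (p m : ℕ) (f : ℕ → ℕ → ℕ) : ∑ u ∈ basePart p m, f (u 0) (u 1)
    = f 0 0 + ∑ a ∈ Finset.Icc 1 p, f a 0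
      + ∑ a ∈ Finset.Icc 1 m, (f (p + a) (2 * a - 1) + f (p + a) (2 * a)) := by
  rw [basePart, Finset.sum_union, Finset.sum_image, sum_Icc_zero (fun a => f (![a, 0, 0] 0) _),
    Finset.sum_biUnion]
  · congr 1
    refine Finset.sum_congr rfl fun a ha => ?_
    rw [Finset.mem_Icc] at ha
    rw [Finset.sum_pair]
    · simp
    · intro h
      have := congrFun h 1
      simp only [Matrix.cons_val] at this
      omega
  · intro a _ b _ hne
    refine Finset.disjoint_left.mpr fun u hu hu' => hne ?_
    simp only [Finset.mem_insert, Finset.mem_singleton] at hu hu'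
    have h1 : u 0 = p + a := by rcases hu with h | h <;> simp [h]
    have h2 : u 0 = p + b := by rcases hu' with h | h <;> simp [h]
    omega
  · intro a _ b _ h
    simpa using congrFun h 0
  · refine Finset.disjoint_left.mpr fun u hu hu' => ?_
    simp only [Finset.mem_image, Finset.mem_biUnion, Finset.mem_Icc, Finset.mem_insert,
      Finset.mem_singleton] at hu hu'
    obtain ⟨a, ha, rfl⟩ := hu
    obtain ⟨b, hb, h | h⟩ := hu' <;> have := congrFun h 0 <;>
      simp only [Matrix.cons_val] at this <;> omega

section TopPart

lemma union_last_injective {S T : Finset (Fin 3 → ℕ)} (hS : ∀ u ∈ S, ∀ w ∈ S, u 2 = w 2 → u = w)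
    (hT : ∀ u ∈ T, ∀ w ∈ T, u 2 = w 2 → u = w) (hST : ∀ u ∈ S, ∀ w ∈ T, u 2 < w 2) :
    ∀ u ∈ S ∪ T, ∀ w ∈ S ∪ T, u 2 = w 2 → u = w := by
  intro u hu w hw h
  rcases Finset.mem_union.mp hu with hu | hu <;> rcases Finset.mem_union.mp hw with hw | hw
  · exact hS u hu w hw h
  · exact absurd h (hST u hu w hw).ne
  · exact absurd h (hST w hw u hu).ne'
  · exact hT u hu w hw h

variable {p m r : ℕ}

lemma topPiece1_last_mem {u : Fin 3 → ℕ} (hu : u ∈ topPiece1 p r) :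
    0 < u 2 ∧ u 2 ≤ 2 * p * r := by
  have := pairedPiece_last_mem hu
  rw [← mul_assoc] at this
  omega

lemma topPiece2_last_mem {u : Fin 3 → ℕ} (hu : u ∈ topPiece2 p m r) :
    2 * p * r < u 2 ∧ u 2 ≤ 2 * p * r + 2 * m ^ 2 := by
  have := pairedPiece_last_mem hu
  rw [← pow_two] at this
  omega

lemma topPiece3_last_mem (hr : r ≤ 2 * m) {u : Fin 3 → ℕ} (hu : u ∈ topPiece3 p m r) :
    2 * p * r + 2 * m ^ 2 < u 2 ∧ u 2 ≤ 2 * m ^ 2 + 4 * p * m := by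
  have h := pairedPiece_last_mem hu
  obtain ⟨d, hd⟩ := Nat.exists_eq_add_of_le hr
  rw [show 2 * m - r = d by omega] at h
  rw [show 4 * p * m = 2 * p * r + 2 * (p * d) by
    rw [mul_assoc 2, ← mul_add, ← mul_add, ← hd]
    ring]
  omega

lemma topPiece4_last_mem {u : Fin 3 → ℕ} (hu : u ∈ topPiece4 p m) :
    2 * m ^ 2 + 4 * p * m < u 2 ∧ u 2 ≤ 4 * m ^ 2 + 4 * p * m := by
  have := pairedPiece_last_mem hu
  rw [← pow_two] at this
  omega

lemma topPart_last_mem (hr : r ≤ 2 * m) {u : Fin 3 → ℕ} (hu : u ∈ topPart p m r) :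
    0 < u 2 ∧ u 2 ≤ 4 * m ^ 2 + 4 * p * m := by
  have hle : 2 * p * r ≤ 4 * p * m := by nlinarith
  simp only [topPart, Finset.mem_union] at hu
  rcases hu with ((hu | hu) | hu) | hu
  · have := topPiece1_last_mem hu
    omega
  · have := topPiece2_last_mem hu
    omega
  · have := topPiece3_last_mem hr hu
    omega
  · have := topPiece4_last_mem hu
    omega

lemma topPiece1_lt_topPiece2 {u w : Fin 3 → ℕ} (hu : u ∈ topPiece1 p r)
    (hw : w ∈ topPiece2 p m r) : u 2 < w 2 :=
  (topPiece1_last_mem hu).2.trans_lt (topPiece2_last_mem hw).1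

lemma lt_topPiece3 (hr : r ≤ 2 * m) {u w : Fin 3 → ℕ} (hu : u ∈ topPiece1 p r ∪ topPiece2 p m r)
    (hw : w ∈ topPiece3 p m r) : u 2 < w 2 := by
  have h3 := topPiece3_last_mem hr hw
  rcases Finset.mem_union.mp hu with hu | hu
  · have := topPiece1_last_mem hu
    omega
  · have := topPiece2_last_mem hu
    omega

lemma lt_topPiece4 (hr : r ≤ 2 * m) {u w : Fin 3 → ℕ}
    (hu : u ∈ topPiece1 p r ∪ topPiece2 p m r ∪ topPiece3 p m r)
    (hw : w ∈ topPiece4 p m) : u 2 < w 2 := by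
  have h4 := topPiece4_last_mem hw
  rcases Finset.mem_union.mp hu with hu | hu
  · rcases Finset.mem_union.mp hu with hu | hu
    · have := topPiece1_last_mem hu
      have hle : 2 * p * r ≤ 4 * p * m := by nlinarith
      omega
    · have := topPiece2_last_mem hu
      have hle : 2 * p * r ≤ 4 * p * m := by nlinarith
      omega
  · have := topPiece3_last_mem hr hu
    omega

lemma topPart_last_injective (hr : r ≤ 2 * m) {u w : Fin 3 → ℕ} (hu : u ∈ topPart p m r)
    (hw : w ∈ topPart p m r) (h : u 2 = w 2) : u = w :=
  union_last_injective
    (union_last_injective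
      (union_last_injective (fun _ hu _ hw => pairedPiece_last_injective hu hw)
        (fun _ hu _ hw => pairedPiece_last_injective hu hw)
        fun _ hu _ hw => topPiece1_lt_topPiece2 hu hw)
      (fun _ hu _ hw => pairedPiece_last_injective hu hw) fun _ hu _ hw => lt_topPiece3 hr hu hw)
    (fun _ hu _ hw => pairedPiece_last_injective hu hw) (fun _ hu _ hw => lt_topPiece4 hr hu hw)
    u hu w hw h

lemma sum_topPart (hr : r ≤ 2 * m) (f : ℕ → ℕ → ℕ) : ∑ u ∈ topPart p m r, f (u 0) (u 1)
    = 2 * (∑ b ∈ Finset.Icc 1 r, ∑ a ∈ Finset.Icc 1 p, f a b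
      + ∑ b ∈ Finset.Icc 1 m, ∑ a ∈ Finset.Icc 1 m,
          f (p + a) (b + if b = 2 * a - 1 ∨ b = 2 * a then m else 0)
      + ∑ b ∈ Finset.Icc 1 (2 * m - r), ∑ a ∈ Finset.Icc 1 p, f (p + m + a) (r + b)
      + ∑ b ∈ Finset.Icc 1 m, ∑ a ∈ Finset.Icc 1 m,
          f (2 * p + m + a) (b + if a = 1 then 0 else m)) := by
  rw [topPart, Finset.sum_union, Finset.sum_union, Finset.sum_union]
  · simp only [topPiece1, topPiece2, topPiece3, topPiece4, sum_pairedPiece]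
    ring
  · exact Finset.disjoint_left.mpr fun u hu hu' => (topPiece1_lt_topPiece2 hu hu').false
  · exact Finset.disjoint_left.mpr fun u hu hu' => (lt_topPiece3 hr hu hu').false
  · exact Finset.disjoint_left.mpr fun u hu hu' => (lt_topPiece4 hr hu hu').false

lemma topPart_coord_le (hm : 1 ≤ m) (hr : r ≤ 2 * m) {u : Fin 3 → ℕ} (hu : u ∈ topPart p m r) :
    u 0 ≤ 2 * p + 2 * m ∧ 1 ≤ u 1 ∧ u 1 ≤ 2 * m := by
  simp only [topPart, topPiece1, topPiece2, topPiece3, topPiece4, Finset.mem_union,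
    mem_pairedPiece] at hu
  rcases hu with ((hu | hu) | hu) | hu <;> obtain ⟨a, b, h1, h2, h3, h4, h5, h6, -⟩ := hu <;>
    (try split_ifs at h6) <;> omega

end TopPart

/-! ### Multiplicities in columns, rows and positions -/

lemma basePart_disjoint_topPart {p m r : ℕ} (hr : r ≤ 2 * m) :
    Disjoint (basePart p m) (topPart p m r) :=
  Finset.disjoint_left.mpr fun _ hu hu' =>
    (topPart_last_mem hr hu').1.ne' (mem_basePart.mp hu).1

lemma sum_base_union_top {p m r : ℕ} (hr : r ≤ 2 * m) (f : ℕ → ℕ → ℕ) :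
    ∑ u ∈ basePart p m ∪ topPart p m r, f (u 0) (u 1)
      = ∑ u ∈ basePart p m, f (u 0) (u 1) + ∑ u ∈ topPart p m r, f (u 0) (u 1) :=
  Finset.sum_union (basePart_disjoint_topPart hr)

lemma card_basePart (p m : ℕ) : (basePart p m).card = p + 1 + 2 * m := by
  have := sum_basePart p m fun _ _ => 1
  simp only [Finset.sum_const, smul_eq_mul, mul_one, Nat.card_Icc] at this
  omega

lemma card_topPart {p m r : ℕ} (hr : r ≤ 2 * m) :
    (topPart p m r).card = 4 * m * p + 4 * m * m := by
  have := sum_topPart hr (p := p) fun _ _ => 1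
  simp only [Finset.sum_const, smul_eq_mul, mul_one, Nat.card_Icc, Nat.add_sub_cancel] at this
  rw [this]
  obtain ⟨d, hd⟩ := Nat.exists_eq_add_of_le hr
  rw [hd, Nat.add_sub_cancel_left]
  have : 2 * p * (2 * m) = 2 * p * (r + d) := congrArg (2 * p * ·) hd
  linarith

section ColumnsAndRows

variable {p m r : ℕ}

lemma agree_col_base (p m : ℕ) : agreeingPairs (basePart p m) {0} = p + 1 + 4 * m := by
  obtain ⟨W, hW⟩ : ∃ W : ℕ → ℕ, ∀ x, W x = if x ≤ p then 1 else if x ≤ p + m then 2 else 0 :=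
    ⟨_, fun _ => rfl⟩
  rw [agreeingPairs_eq_of_sum (fun u => u 0)
    (fun f => f 0 + ∑ a ∈ Finset.Icc 1 p, f a + 2 * ∑ a ∈ Finset.Icc 1 m, f (p + a)) W (by simp)]
  · have c1 : ∀ a ∈ Finset.Icc 1 p, W a = 1 := fun a ha => by
      rw [Finset.mem_Icc] at ha
      rw [hW, if_pos (by omega)]
    have c2 : ∀ a ∈ Finset.Icc 1 m, W (p + a) = 2 := fun a ha => by
      rw [Finset.mem_Icc] at ha
      rw [hW, if_neg (by omega), if_pos (by omega)]
    rw [Finset.sum_congr rfl c1, Finset.sum_congr rfl c2, hW, if_pos (by omega)]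
    simp
    ring
  · intro f
    rw [sum_basePart p m fun x _ => f x, Finset.mul_sum]
    simp only [two_mul]
  · intro x
    simp only [sum_Icc_ite_eq_add, sum_Icc_ite_eq, hW]
    split_ifs <;> omega

lemma agree_row_base (p m : ℕ) :
    agreeingPairs (basePart p m) {1} = (p + 1) * (p + 1) + 2 * m := by
  obtain ⟨W, hW⟩ : ∃ W : ℕ → ℕ, ∀ x, W x = if x = 0 then p + 1 else if x ≤ 2 * m then 1 else 0 :=
    ⟨_, fun _ => rfl⟩
  rw [agreeingPairs_eq_of_sum (fun u => u 1)
    (fun f => (p + 1) * f 0 + ∑ a ∈ Finset.Icc 1 (2 * m), f a) W (by simp)]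
  · have c1 : ∀ a ∈ Finset.Icc 1 (2 * m), W a = 1 := fun a ha => by
      rw [Finset.mem_Icc] at ha
      rw [hW, if_neg (by omega), if_pos (by omega)]
    rw [Finset.sum_congr rfl c1, hW, if_pos rfl]
    simp
  · intro f
    rw [sum_basePart p m fun _ y => f y, sum_Icc_two_mul]
    simp
    ring
  · intro x
    simp only [sum_Icc_ite_eq, hW]
    split_ifs <;> omega

lemma agree_col (hr : r ≤ 2 * m) : agreeingPairs (basePart p m ∪ topPart p m r) {0}
    = 1 + p * (1 + 2 * r) ^ 2 + m * (2 + 2 * m) ^ 2 + p * (2 * (2 * m - r)) ^ 2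
      + m * (2 * m) ^ 2 := by
  obtain ⟨W, hW⟩ : ∃ W : ℕ → ℕ, ∀ x, W x = if x = 0 then 1 else if x ≤ p then 1 + 2 * r else
      if x ≤ p + m then 2 + 2 * m else if x ≤ 2 * p + m then 2 * (2 * m - r) else
      if x ≤ 2 * p + 2 * m then 2 * m else 0 :=
    ⟨_, fun _ => rfl⟩
  rw [agreeingPairs_eq_of_sum (fun u => u 0)
    (fun f => f 0 + (1 + 2 * r) * ∑ a ∈ Finset.Icc 1 p, f a
      + (2 + 2 * m) * ∑ a ∈ Finset.Icc 1 m, f (p + a)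
      + 2 * (2 * m - r) * ∑ a ∈ Finset.Icc 1 p, f (p + m + a)
      + 2 * m * ∑ a ∈ Finset.Icc 1 m, f (2 * p + m + a)) W (by simp)]
  · have c1 : ∀ a ∈ Finset.Icc 1 p, W a = 1 + 2 * r := fun a ha => by
      rw [Finset.mem_Icc] at ha
      rw [hW, if_neg (by omega), if_pos (by omega)]
    have c2 : ∀ a ∈ Finset.Icc 1 m, W (p + a) = 2 + 2 * m := fun a ha => by
      rw [Finset.mem_Icc] at ha
      rw [hW, if_neg (by omega), if_neg (by omega), if_pos (by omega)]
    have c3 : ∀ a ∈ Finset.Icc 1 p, W (p + m + a) = 2 * (2 * m - r) := fun a ha => by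
      rw [Finset.mem_Icc] at ha
      rw [hW, if_neg (by omega), if_neg (by omega), if_neg (by omega), if_pos (by omega)]
    have c4 : ∀ a ∈ Finset.Icc 1 m, W (2 * p + m + a) = 2 * m := fun a ha => by
      rw [Finset.mem_Icc] at ha
      rw [hW, if_neg (by omega), if_neg (by omega), if_neg (by omega), if_neg (by omega),
        if_pos (by omega)]
    rw [Finset.sum_congr rfl c1, Finset.sum_congr rfl c2, Finset.sum_congr rfl c3,
      Finset.sum_congr rfl c4, hW, if_pos rfl]
    simp
    ring
  · intro f
    rw [sum_base_union_top hr fun x _ => f x, sum_basePart p m fun x _ => f x,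
      sum_topPart hr fun x _ => f x]
    simp only [Finset.sum_const, smul_eq_mul, Nat.card_Icc, Nat.add_sub_cancel, ← two_mul,
      ← Finset.mul_sum]
    ring
  · intro x
    simp only [sum_Icc_ite_eq_add, sum_Icc_ite_eq, hW]
    split_ifs <;> omega

/-- In row `b` of the second constituent exactly one point is shifted, the one with
`a = ⌈b / 2⌉`; in row `b` of the fourth, all but the one with `a = 1` are. Hence together they have
`m` index pairs in each of the rows `1, …, 2 m`. -/
lemma sum_shifted_rows (f : ℕ → ℕ) :
    ∑ b ∈ Finset.Icc 1 m, ∑ a ∈ Finset.Icc 1 m,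
        f (b + if b = 2 * a - 1 ∨ b = 2 * a then m else 0)
      + ∑ b ∈ Finset.Icc 1 m, ∑ a ∈ Finset.Icc 1 m, f (b + if a = 1 then 0 else m)
      = m * ∑ b ∈ Finset.Icc 1 (2 * m), f b := by
  have h2 : ∑ b ∈ Finset.Icc 1 (2 * m), f b = ∑ b ∈ Finset.Icc 1 m, (f b + f (m + b)) := by
    rw [two_mul, sum_Icc_add, Finset.sum_add_distrib]
  rw [h2, ← Finset.sum_add_distrib, Finset.mul_sum]
  refine Finset.sum_congr rfl fun b hb => ?_
  rw [Finset.mem_Icc] at hb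
  -- `(b + 1) / 2` is the rounded-up half of `b`, the only `a` with `b = 2 a - 1` or `b = 2 a`.
  have e1 : (b + 1) / 2 ∈ Finset.Icc 1 m := Finset.mem_Icc.mpr (by omega)
  have e2 : 1 ∈ Finset.Icc 1 m := Finset.mem_Icc.mpr (by omega)
  rw [← Finset.add_sum_erase _ _ e1, ← Finset.add_sum_erase _ (fun a => f (b + _)) e2,
    Finset.sum_congr (s₁ := (Finset.Icc 1 m).erase ((b + 1) / 2)) (g := fun _ => f b) rfl,
    Finset.sum_congr (s₁ := (Finset.Icc 1 m).erase 1) (g := fun _ => f (m + b)) rfl,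
    if_pos (by omega)]
  · simp only [Finset.sum_const, Finset.card_erase_of_mem e1, Finset.card_erase_of_mem e2,
      Nat.card_Icc, smul_eq_mul, if_true, add_zero]
    obtain ⟨k, rfl⟩ : ∃ k, m = k + 1 := ⟨m - 1, by omega⟩
    simp only [Nat.add_sub_cancel, add_comm b]
    ring
  · intro a ha
    rw [if_neg (Finset.ne_of_mem_erase ha), add_comm]
  · intro a ha
    have h1 := Finset.ne_of_mem_erase ha
    have h2 := Finset.mem_Icc.mp (Finset.mem_of_mem_erase ha)
    rw [if_neg (by omega), add_zero]

lemma agree_row (hr : r ≤ 2 * m) : agreeingPairs (basePart p m ∪ topPart p m r) {1}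
    = (p + 1) ^ 2 + 2 * m * (1 + 2 * p + 2 * m) ^ 2 := by
  obtain ⟨W, hW⟩ : ∃ W : ℕ → ℕ, ∀ x, W x =
      if x = 0 then p + 1 else if x ≤ 2 * m then 1 + 2 * p + 2 * m else 0 :=
    ⟨_, fun _ => rfl⟩
  rw [agreeingPairs_eq_of_sum (fun u => u 1)
    (fun f => (p + 1) * f 0 + (1 + 2 * p + 2 * m) * ∑ a ∈ Finset.Icc 1 (2 * m), f a) W (by simp)]
  · have c1 : ∀ a ∈ Finset.Icc 1 (2 * m), W a = 1 + 2 * p + 2 * m := fun a ha => by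
      rw [Finset.mem_Icc] at ha
      rw [hW, if_neg (by omega), if_pos (by omega)]
    rw [Finset.sum_congr rfl c1, hW, if_pos rfl]
    simp
    ring
  · intro f
    rw [sum_base_union_top hr fun _ y => f y, sum_basePart p m fun _ y => f y,
      sum_topPart hr fun _ y => f y, sum_Icc_two_mul]
    have h1 := sum_shifted_rows (m := m) f
    have h2 : ∑ a ∈ Finset.Icc 1 (2 * m), f a
        = ∑ b ∈ Finset.Icc 1 r, f b + ∑ b ∈ Finset.Icc 1 (2 * m - r), f (r + b) := by
      rw [← sum_Icc_add, Nat.add_sub_cancel' hr]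
    simp only [Finset.sum_const, smul_eq_mul, Nat.card_Icc, Nat.add_sub_cancel, ← Finset.mul_sum]
    have h3 := congrArg (2 * p * ·) h2
    simp only at h3
    linarith
  · intro x
    simp only [sum_Icc_ite_eq, hW]
    split_ifs <;> omega

end ColumnsAndRows

section Positions

/-- The pairs `(X a b, Y a b)` for `1 ≤ a ≤ n`, `1 ≤ b ≤ n'`. -/
def positions (n n' : ℕ) (X Y : ℕ → ℕ → ℕ) : Finset (ℕ × ℕ) :=
  (Finset.Icc 1 n ×ˢ Finset.Icc 1 n').image fun q => (X q.1 q.2, Y q.1 q.2)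

lemma mem_positions {n n' : ℕ} {X Y : ℕ → ℕ → ℕ} {t : ℕ × ℕ} : t ∈ positions n n' X Y ↔
    ∃ a b, 1 ≤ a ∧ a ≤ n ∧ 1 ≤ b ∧ b ≤ n' ∧ t.1 = X a b ∧ t.2 = Y a b := by
  simp only [positions, Finset.mem_image, Finset.mem_product, Finset.mem_Icc, Prod.exists,
    Prod.ext_iff, eq_comm (a := t.1), eq_comm (a := t.2), and_assoc]

lemma sum_positions {n n' : ℕ} {X Y : ℕ → ℕ → ℕ} (f : ℕ → ℕ → ℕ)
    (hinj : ∀ a b a' b', 1 ≤ a → a ≤ n → 1 ≤ b → b ≤ n' → 1 ≤ a' → a' ≤ n → 1 ≤ b' → b' ≤ n' →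
      X a b = X a' b' → Y a b = Y a' b' → a = a' ∧ b = b') :
    ∑ t ∈ positions n n' X Y, f t.1 t.2
      = ∑ b ∈ Finset.Icc 1 n', ∑ a ∈ Finset.Icc 1 n, f (X a b) (Y a b) := by
  rw [positions, Finset.sum_image, Finset.sum_product_right]
  rintro ⟨a, b⟩ h ⟨a', b'⟩ h' heq
  simp only [Finset.coe_product, Finset.coe_Icc, Set.mem_prod, Set.mem_Icc, Prod.mk.injEq]
    at h h' heq
  have := hinj a b a' b' h.1.1 h.1.2 h.2.1 h.2.2 h'.1.1 h'.1.2 h'.2.1 h'.2.2 heq.1 heq.2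
  rw [this.1, this.2]

variable {p m r : ℕ}

/-- The positions of the points of the base block in the first two coordinates are pairwise
distinct, except that each point of the top part shares its position with its partner. -/
lemma agree_position (hm : 2 ≤ m) (hr : r ≤ 2 * m) :
    agreeingPairs (basePart p m ∪ topPart p m r) {0, 1}
      = p + 1 + 2 * m + 2 * (4 * m * p + 4 * m * m) := by
  obtain ⟨T1, eT1⟩ : ∃ T, T = positions p r (fun a _ => a) (fun _ b => b) :=
    ⟨_, rfl⟩
  obtain ⟨T2, eT2⟩ : ∃ T, T = positions m m (fun a _ => p + a)
      (fun a b => b + if b = 2 * a - 1 ∨ b = 2 * a then m else 0) := ⟨_, rfl⟩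
  obtain ⟨T3, eT3⟩ : ∃ T, T = positions p (2 * m - r) (fun a _ => p + m + a) (fun _ b => r + b) :=
    ⟨_, rfl⟩
  obtain ⟨T4, eT4⟩ : ∃ T, T = positions m m (fun a _ => 2 * p + m + a)
      (fun a b => b + if a = 1 then 0 else m) := ⟨_, rfl⟩
  obtain ⟨P, eP⟩ : ∃ P, P = (basePart p m).image fun u => (u 0, u 1) := ⟨_, rfl⟩
  have hT1 : ∀ t ∈ T1, 1 ≤ t.1 ∧ t.1 ≤ p ∧ 1 ≤ t.2 := by
    intro t ht
    rw [eT1, mem_positions] at ht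
    obtain ⟨a, b, h⟩ := ht
    omega
  have hT2 : ∀ t ∈ T2, p < t.1 ∧ t.1 ≤ p + m ∧ 1 ≤ t.2 ∧ t.2 + 1 ≠ 2 * (t.1 - p) ∧
      t.2 ≠ 2 * (t.1 - p) := by
    intro t ht
    rw [eT2, mem_positions] at ht
    obtain ⟨a, b, h1, h2, h3, h4, h5, h6⟩ := ht
    split_ifs at h6 <;> omega
  have hT3 : ∀ t ∈ T3, p + m < t.1 ∧ t.1 ≤ 2 * p + m ∧ 1 ≤ t.2 := by
    intro t ht
    rw [eT3, mem_positions] at ht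
    obtain ⟨a, b, h⟩ := ht
    omega
  have hT4 : ∀ t ∈ T4, 2 * p + m < t.1 ∧ 1 ≤ t.2 := by
    intro t ht
    rw [eT4, mem_positions] at ht
    obtain ⟨a, b, h⟩ := ht
    omega
  have hP : ∀ t ∈ P, (t.1 ≤ p ∧ t.2 = 0) ∨
      (p < t.1 ∧ t.1 ≤ p + m ∧ (t.2 + 1 = 2 * (t.1 - p) ∨ t.2 = 2 * (t.1 - p))) := by
    intro t ht
    rw [eP] at ht
    obtain ⟨u, hu, rfl⟩ := Finset.mem_image.mp ht
    exact (mem_basePart.mp hu).2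
  obtain ⟨T, eT⟩ : ∃ T, T = T1 ∪ T2 ∪ T3 ∪ T4 := ⟨_, rfl⟩
  have hPT : ∀ t ∈ P, t ∉ T := by
    intro t ht ht'
    have h0 := hP t ht
    simp only [eT, Finset.mem_union] at ht'
    rcases ht' with ((h | h) | h) | h
    · have := hT1 t h
      omega
    · have := hT2 t h
      omega
    · have := hT3 t h
      omega
    · have := hT4 t h
      omega
  have hsum : ∀ f : ℕ × ℕ → ℕ, ∑ u ∈ basePart p m ∪ topPart p m r, f (u 0, u 1)
      = ∑ t ∈ P, f t + 2 * ∑ t ∈ T, f t := by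
    intro f
    have s1 : ∑ t ∈ T1, f t = _ := eT1 ▸ sum_positions (fun x y => f (x, y)) (by
      intros
      omega)
    have s2 : ∑ t ∈ T2, f t = _ := eT2 ▸ sum_positions (fun x y => f (x, y)) (by
      intro a b a' b' h1 h2 h3 h4 h5 h6 h7 h8 h9 h10
      split_ifs at h10 <;> omega)
    have s3 : ∑ t ∈ T3, f t = _ := eT3 ▸ sum_positions (fun x y => f (x, y)) (by
      intros
      omega)
    have s4 : ∑ t ∈ T4, f t = _ := eT4 ▸ sum_positions (fun x y => f (x, y)) (by
      intro a b a' b' h1 h2 h3 h4 h5 h6 h7 h8 h9 h10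
      split_ifs at h10 <;> omega)
    rw [sum_base_union_top hr fun x y => f (x, y), sum_topPart hr fun x y => f (x, y), ← s1, ← s2,
      ← s3, ← s4, eP, eT, Finset.sum_image, Finset.sum_union, Finset.sum_union, Finset.sum_union]
    · refine Finset.disjoint_left.mpr fun t h h' => ?_
      have h1 := hT1 t h
      have h2 := hT2 t h'
      omega
    · refine Finset.disjoint_left.mpr fun t h h' => ?_
      have h3 := hT3 t h'
      rcases Finset.mem_union.mp h with h | h
      · have h1 := hT1 t h
        omega
      · have h2 := hT2 t h
        omega
    · refine Finset.disjoint_left.mpr fun t h h' => ?_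
      have h4 := hT4 t h'
      simp only [Finset.mem_union] at h
      rcases h with (h | h) | h
      · have h1 := hT1 t h
        omega
      · have h2 := hT2 t h
        omega
      · have h3 := hT3 t h
        omega
    · intro u hu w hw h
      have hu2 := (mem_basePart.mp hu).1
      have hw2 := (mem_basePart.mp hw).1
      simp only [Prod.mk.injEq] at h
      funext i
      fin_cases i
      · exact h.1
      · exact h.2
      · exact hu2.trans hw2.symm
  have hcardP : P.card = p + 1 + 2 * m := by
    rw [← card_basePart, eP]
    refine Finset.card_image_of_injOn fun u hu w hw h => ?_
    have hu2 := (mem_basePart.mp hu).1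
    have hw2 := (mem_basePart.mp hw).1
    simp only [Prod.mk.injEq] at h
    funext i
    fin_cases i
    · exact h.1
    · exact h.2
    · exact hu2.trans hw2.symm
  have hcardT : 2 * T.card = 4 * m * p + 4 * m * m := by
    have h := hsum fun _ => 1
    simp only [Finset.sum_const, smul_eq_mul, mul_one] at h
    rw [Finset.card_union_of_disjoint (basePart_disjoint_topPart hr), card_basePart, hcardP,
      card_topPart hr] at h
    omega
  rw [agreeingPairs_eq_of_sum (fun u => (u 0, u 1)) (fun f => ∑ t ∈ P, f t + 2 * ∑ t ∈ T, f t)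
    (fun x => if x ∈ P then 1 else if x ∈ T then 2 else 0) (by simp) hsum]
  · rw [Finset.sum_congr (s₁ := P) (g := fun _ => 1) rfl fun x hx => if_pos hx,
      Finset.sum_congr (s₁ := T) (g := fun _ => 2) rfl fun x hx =>
        (if_neg fun h => hPT x h hx).trans (if_pos hx)]
    simp only [Finset.sum_const, smul_eq_mul, mul_one]
    omega
  · intro x
    simp only [Finset.sum_ite_eq]
    by_cases hx : x ∈ P
    · rw [if_pos hx, if_neg (hPT x hx), if_pos hx, mul_zero, add_zero]
    · rw [if_neg hx, if_neg hx]
      by_cases hx' : x ∈ T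
      · rw [if_pos hx', if_pos hx']
      · rw [if_neg hx', if_neg hx', mul_zero, add_zero]

end Positions

/-! ### The three-dimensional designs -/

lemma agreeingPairs_congr {s : ℕ} {B : Finset (Fin s → ℕ)} {I J : Finset (Fin s)}
    (h : ∀ u ∈ B, ∀ w ∈ B, (∀ i ∈ I, u i = w i) ↔ ∀ i ∈ J, u i = w i) :
    agreeingPairs B I = agreeingPairs B J := by
  refine Finset.sum_congr rfl fun u hu => Finset.sum_congr rfl fun w hw => ?_
  simp only [h u hu w hw]

lemma agreeingPairs_base_insert (p m : ℕ) (I : Finset (Fin 3)) :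
    agreeingPairs (basePart p m) (insert 2 I) = agreeingPairs (basePart p m) I := by
  refine agreeingPairs_congr fun u hu w hw => ?_
  simp [(mem_basePart.mp hu).1, (mem_basePart.mp hw).1]

lemma agreeingPairs_insert {p m r : ℕ} (hr : r ≤ 2 * m) (I : Finset (Fin 3)) :
    agreeingPairs (basePart p m ∪ topPart p m r) (insert 2 I)
      = agreeingPairs (basePart p m) I + (4 * m * p + 4 * m * m) := by
  rw [agreeingPairs_union (Finset.mem_insert_self _ _), card_topPart hr,
    agreeingPairs_base_insert]
  · intro u hu w hw h
    rw [(mem_basePart.mp hu).1] at h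
    exact (topPart_last_mem hr hw).1.ne h
  · exact fun u hu w hw => topPart_last_injective hr hu hw

lemma agree_position_base (p m : ℕ) : agreeingPairs (basePart p m) {0, 1} = p + 1 + 2 * m := by
  rw [← card_basePart, agreeingPairs, Finset.card_eq_sum_ones]
  refine Finset.sum_congr rfl fun u hu => ?_
  rw [Finset.sum_eq_single u]
  · simp
  · intro w hw hne
    refine if_neg fun h => hne ?_
    funext i
    fin_cases i
    · exact (h 0 (by simp)).symm
    · exact (h 1 (by simp)).symm
    · exact (mem_basePart.mp hw).1.trans (mem_basePart.mp hu).1.symm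
  · exact fun h => absurd hu h

/-- The counting criterion for the base block of `𝒟(3, p)`. Given `p² = 2 m + p`, seven of the eight
conditions hold for every `r`; the condition `hcol` on the first coordinate is what the choice
of `r` achieves. -/
lemma agreeingPairs_base_union_top {p m r : ℕ} (hm : 2 ≤ m) (hr : r ≤ 2 * m)
    (hp : p ^ 2 = 2 * m + p)
    (hcol : 1 + p * (1 + 2 * r) ^ 2 + m * (2 + 2 * m) ^ 2 + p * (2 * (2 * m - r)) ^ 2
      + m * (2 * m) ^ 2 = p + 2 * m + (4 * m * p + 4 * m * m)
        + (2 * m + 1) * (4 * m * p + 4 * m * m + 1)) (I : Finset (Fin 3)) :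
    agreeingPairs (basePart p m ∪ topPart p m r) I + 1
      = (basePart p m ∪ topPart p m r).card
        + ∏ i, if i ∈ I then 1 else
            (![2 * m + 2 * p + 1, 2 * m + 1, 4 * m * p + 4 * m * m + 1] : Fin 3 → ℕ) i := by
  have hcard : (basePart p m ∪ topPart p m r).card = p + 1 + 2 * m + (4 * m * p + 4 * m * m) := by
    rw [Finset.card_union_of_disjoint (basePart_disjoint_topPart hr), card_basePart,
      card_topPart hr]
  have hI : I = ∅ ∨ I = {0} ∨ I = {1} ∨ I = {0, 1} ∨ I = insert 2 ∅ ∨ I = insert 2 {0} ∨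
      I = insert 2 {1} ∨ I = insert 2 {0, 1} := by
    revert I
    decide
  rw [hcard, Fin.prod_univ_three]
  rcases hI with rfl | rfl | rfl | rfl | rfl | rfl | rfl | rfl
  · rw [agreeingPairs_empty, hcard]
    simp
    grind
  · rw [agree_col hr]
    simp
    grind
  · rw [agree_row hr]
    simp
    grind
  · rw [agree_position hm hr]
    simp
    grind
  · rw [agreeingPairs_insert hr, agreeingPairs_empty, card_basePart]
    simp
    grind
  · rw [agreeingPairs_insert hr, agree_col_base]
    simp
    grind
  · rw [agreeingPairs_insert hr, agree_row_base]
    simp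
    grind
  · rw [agreeingPairs_insert hr, agree_position_base]
    simp

/-- The integer coordinates of the base block are representatives modulo the grid sizes. -/
lemma base_union_top_lt {p m r : ℕ} (hm : 1 ≤ m) (hr : r ≤ 2 * m) {u : Fin 3 → ℕ}
    (hu : u ∈ basePart p m ∪ topPart p m r) (i : Fin 3) :
    u i < (![2 * m + 2 * p + 1, 2 * m + 1, 4 * m * p + 4 * m * m + 1] : Fin 3 → ℕ) i := by
  rcases Finset.mem_union.mp hu with hu | hu
  · have := mem_basePart.mp hu
    fin_cases i
    · change u 0 < 2 * m + 2 * p + 1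
      omega
    · change u 1 < 2 * m + 1
      omega
    · change u 2 < _
      rw [this.1]
      exact Nat.succ_pos _
  · have h1 := topPart_coord_le hm hr hu
    have h2 := topPart_last_mem hr hu
    fin_cases i
    · change u 0 < 2 * m + 2 * p + 1
      omega
    · change u 1 < 2 * m + 1
      omega
    · change u 2 < 4 * m * p + 4 * m * m + 1
      rw [pow_two] at h2
      linarith [mul_right_comm 4 m p]

/-- The grid sizes in terms of `m = (p² - p) / 2`. -/
lemma sizes3_eq {p m : ℕ} (hp : p ^ 2 = 2 * m + p) :
    sizes3 p = ![2 * m + 2 * p + 1, 2 * m + 1, 4 * m * p + 4 * m * m + 1] := by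
  have h4 : p ^ 4 = 4 * m * p + 4 * m * m + p ^ 2 := by
    rw [show p ^ 4 = p ^ 2 * p ^ 2 by ring]
    nlinarith [hp]
  have h1 : p ^ 2 + p + 1 = 2 * m + 2 * p + 1 := by omega
  have h2 : p ^ 2 - p + 1 = 2 * m + 1 := by omega
  have h3 : p ^ 4 - p ^ 2 + 1 = 4 * m * p + 4 * m * m + 1 := by rw [h4, Nat.add_sub_cancel]
  rw [sizes3, h1, h2, h3]

lemma exists_sq_eq (p : ℕ) : ∃ m, p ^ 2 = 2 * m + p := by
  obtain ⟨m, hm⟩ := (Nat.even_mul_pred_self p).two_dvd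
  refine ⟨m, ?_⟩
  rw [← hm]
  cases p <;> simp
  ring

lemma prod_sizes3 (p : ℕ) : ∏ i, sizes3 p i = p ^ 8 + p ^ 4 + 1 := by
  obtain ⟨m, hm⟩ := exists_sq_eq p
  rw [sizes3_eq hm, Fin.prod_univ_three]
  simp
  grind

lemma one_lt_sizes3 {p : ℕ} (hp : 1 < p) (i : Fin 3) : 1 < sizes3 p i := by
  obtain ⟨m, hm⟩ := exists_sq_eq p
  have hm0 : 0 < m := by nlinarith
  rw [sizes3_eq hm]
  fin_cases i <;> simp <;> omega

lemma natCard_grid_sizes3 {p : ℕ} (hp : 1 < p) :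
    Nat.card (Grid (sizes3 p)) = p ^ 8 + p ^ 4 + 1 := by
  have hne : ∀ i, NeZero (sizes3 p i) := fun i => ⟨by have := one_lt_sizes3 hp i; omega⟩
  rw [← prod_sizes3, Nat.card_eq_fintype_card, Fintype.card_pi]
  simp only [ZMod.card]

/-- For `p > 2` the base block is the union of `basePart` and `topPart`. -/
lemma block_eq {p m : ℕ} (hp : 2 < p) (hm : p ^ 2 = 2 * m + p) :
    block1 p ∪ block2 p ∪ block3 p = basePart p m ∪
      topPart p m (if p % 2 = 1 then (p ^ 2 - 1) / 2 else (p ^ 2 - 2 * p) / 2) := by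
  rw [block3, if_neg (by omega), block3Gen_eq, show (p ^ 2 - p) / 2 = m by omega, block1, block2,
    basePart, show (p ^ 2 - p) / 2 = m by omega]

lemma exists_isTwoDesign_design3 {p : ℕ} (hp : 2 < p) :
    ∃ lam, (design3 p).IsTwoDesign (p ^ 8 + p ^ 4 + 1) (p ^ 4 + 1) lam := by
  obtain ⟨m, hm⟩ := exists_sq_eq p
  have hm2 : p ≤ m := by nlinarith
  obtain ⟨r, hr, hrm, hcol⟩ : ∃ r,
      r = (if p % 2 = 1 then (p ^ 2 - 1) / 2 else (p ^ 2 - 2 * p) / 2) ∧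
      r ≤ 2 * m ∧ 1 + p * (1 + 2 * r) ^ 2 + m * (2 + 2 * m) ^ 2 + p * (2 * (2 * m - r)) ^ 2
      + m * (2 * m) ^ 2 = p + 2 * m + (4 * m * p + 4 * m * m)
        + (2 * m + 1) * (4 * m * p + 4 * m * m + 1) := by
    refine ⟨_, rfl, ?_⟩
    split_ifs with hodd
    · obtain ⟨r, hr⟩ : ∃ r, r = (p ^ 2 - 1) / 2 := ⟨_, rfl⟩
      have h1 : 1 + 2 * r = 2 * m + p := by omega
      rw [← hr]
      refine ⟨by omega, ?_⟩
      obtain ⟨d, hd⟩ := Nat.exists_eq_add_of_le (show r ≤ 2 * m by omega)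
      rw [show 2 * m - r = d by omega, h1]
      have h2 : 2 * d + p = 2 * m + 1 := by omega
      grind
    · obtain ⟨r, hr⟩ : ∃ r, r = (p ^ 2 - 2 * p) / 2 := ⟨_, rfl⟩
      have h1 : 2 * r + p = 2 * m := by omega
      rw [← hr]
      refine ⟨by omega, ?_⟩
      obtain ⟨d, hd⟩ := Nat.exists_eq_add_of_le (show r ≤ 2 * m by omega)
      rw [show 2 * m - r = d by omega]
      have h2 : 2 * d = 2 * m + p := by omega
      grind
  have hcard : (basePart p m ∪ topPart p m r).card = p ^ 4 + 1 := by
    rw [Finset.card_union_of_disjoint (basePart_disjoint_topPart hrm), card_basePart,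
      card_topPart hrm]
    grind
  have key := gridStructure_isTwoDesign (sizes3 p) (basePart p m ∪ topPart p m r)
    (fun u hu i => by
      rw [sizes3_eq hm]
      exact base_union_top_lt (by omega) hrm hu i)
    (fun I => by
      rw [sizes3_eq hm]
      exact agreeingPairs_base_union_top (by omega) hrm hm hcol I)
    (by rw [hcard]; exact Nat.succ_le_succ (Nat.pow_pos (by omega)))
    (by
      rw [hcard, prod_sizes3]
      have : 0 < p ^ 8 := Nat.pow_pos (by omega)
      omega)
  rwa [hcard, prod_sizes3, hr, ← block_eq hp hm] at key

lemma exists_isTwoDesign_design3_two :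
    ∃ lam, (design3 2).IsTwoDesign (2 ^ 8 + 2 ^ 4 + 1) (2 ^ 4 + 1) lam := by
  have hcard : (block1 2 ∪ block2 2 ∪ block3 2).card = 2 ^ 4 + 1 := by decide +kernel
  have key := gridStructure_isTwoDesign (sizes3 2) (block1 2 ∪ block2 2 ∪ block3 2)
    (by decide +kernel) (by decide +kernel) (by decide +kernel) (by decide +kernel)
  rwa [hcard, prod_sizes3] at key

/-! ### The four-dimensional design -/

/-- The parameters `(a, b, l, u, n, t)` of the rows `block4Row a b l u n t` that make up
`block4Rest`. -/
def rowParams : List (ℕ × ℕ × ℕ × ℕ × ℕ × ℕ) :=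
  [(0, 0, 9, 12, 0, 16), (1, 0, 1, 4, 8, 0), (2, 0, 5, 8, 8, 0), (0, 1, 5, 8, 16, 0),
    (0, 1, 11, 12, 12, 0), (1, 1, 3, 4, 32, 0), (1, 1, 9, 12, 24, 0), (2, 1, 1, 4, 48, 0),
    (2, 1, 7, 8, 44, 0), (0, 2, 5, 10, 52, 0), (1, 2, 1, 2, 72, 0), (1, 2, 9, 12, 60, 0),
    (2, 2, 1, 6, 84, 0), (3, 0, 1, 12, 96, 0), (3, 1, 3, 4, 116, 0), (3, 1, 7, 8, 112, 0),
    (3, 1, 11, 12, 108, 0), (3, 2, 1, 2, 132, 0), (3, 2, 5, 6, 128, 0), (3, 2, 9, 10, 124, 0),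
    (4, 0, 9, 12, 128, 0), (5, 0, 1, 4, 152, 0), (6, 0, 5, 8, 152, 0), (4, 1, 5, 8, 160, 0),
    (4, 1, 11, 12, 156, 0), (5, 1, 3, 4, 176, 0), (5, 1, 9, 12, 168, 0), (6, 1, 1, 4, 192, 0),
    (6, 1, 7, 8, 188, 0), (4, 2, 5, 10, 196, 0), (5, 2, 1, 2, 216, 0), (5, 2, 9, 12, 204, 0),
    (6, 2, 1, 6, 228, 0)]

/-- The first three coordinates of the `17` points of `block4Zero`. -/
def zeroPositions : List (ℕ × ℕ × ℕ) :=
  [(0, 0, 0), (1, 0, 0), (2, 0, 0), (3, 1, 0), (3, 2, 0), (4, 1, 1), (4, 1, 2), (4, 2, 3),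
    (4, 2, 4), (5, 1, 5), (5, 1, 6), (5, 2, 7), (5, 2, 8), (6, 1, 9), (6, 1, 10), (6, 2, 11),
    (6, 2, 12)]

/-- The row of points with the given parameters `(a, b, l, u, n, t)`. -/
def paramRow (R : ℕ × ℕ × ℕ × ℕ × ℕ × ℕ) : Finset (Fin 4 → ℕ) :=
  block4Row R.1 R.2.1 R.2.2.1 R.2.2.2.1 R.2.2.2.2.1 R.2.2.2.2.2

/-- The positions of the points of the base block of `𝒟(4, 2)` in the first three coordinates, as a
list of segments: the tuple `(k, a, b, l, u)` stands for the positions `(a, b, c)` with `l ≤ c ≤ u`,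
each occupied by `k` points. -/
def segments : List (ℕ × ℕ × ℕ × ℕ × ℕ) :=
  zeroPositions.map (fun z => (1, z.1, z.2.1, z.2.2, z.2.2)) ++
    rowParams.map fun R => (2, R.1, R.2.1, R.2.2.1, R.2.2.2.1)

lemma block4Rest_eq : block4Rest = rowParams.toFinset.biUnion paramRow := by
  simp only [rowParams, List.toFinset_cons, List.toFinset_nil, Finset.biUnion_insert,
    Finset.biUnion_empty, Finset.union_empty, paramRow, block4Rest, Finset.union_assoc]

lemma block4Zero_eq :
    block4Zero = (zeroPositions.map fun z => ![z.1, z.2.1, z.2.2, 0]).toFinset := by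
  decide +kernel

section Row

variable {a b l u n t : ℕ}

lemma mem_block4Row (h : t + 1 ≤ 2 * l + n) {x : Fin 4 → ℕ} : x ∈ block4Row a b l u n t ↔
    x 0 = a ∧ x 1 = b ∧ l ≤ x 2 ∧ x 2 ≤ u ∧
      (x 3 + 1 + t = 2 * x 2 + n ∨ x 3 + t = 2 * x 2 + n) := by
  have hvec : ∀ a b c d : ℕ, x = ![a, b, c, d] ↔ x 0 = a ∧ x 1 = b ∧ x 2 = c ∧ x 3 = d := by
    intro a b c d
    simp [funext_iff, Fin.forall_fin_succ]
  simp only [block4Row, Finset.mem_biUnion, Finset.mem_Icc, Finset.mem_insert,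
    Finset.mem_singleton, hvec]
  constructor
  · rintro ⟨c, hc⟩
    omega
  · intro hx
    exact ⟨x 2, by omega⟩

lemma sum_block4Row (h : t + 1 ≤ 2 * l + n) (f : ℕ → ℕ → ℕ → ℕ) :
    ∑ x ∈ block4Row a b l u n t, f (x 0) (x 1) (x 2) = 2 * ∑ c ∈ Finset.Icc l u, f a b c := by
  rw [block4Row, Finset.sum_biUnion, Finset.mul_sum]
  · refine Finset.sum_congr rfl fun c hc => ?_
    rw [Finset.mem_Icc] at hc
    rw [Finset.sum_pair]
    · simp [two_mul]
    · intro he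
      have := congrFun he 3
      simp only [Matrix.cons_val] at this
      omega
  · intro c _ c' _ hne
    refine Finset.disjoint_left.mpr fun x hx hx' => hne ?_
    simp only [Finset.mem_insert, Finset.mem_singleton] at hx hx'
    have h1 : x 2 = c := by rcases hx with h | h <;> simp [h]
    have h2 : x 2 = c' := by rcases hx' with h | h <;> simp [h]
    exact h1.symm.trans h2

end Row

/-- The last coordinates of the points of a row are at least `1`. -/
lemma rowParams_pos : ∀ R ∈ rowParams,
    R.2.2.2.2.2 + 2 ≤ 2 * R.2.2.1 + R.2.2.2.2.1 := by
  decide +kernel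

/-- The last coordinates of different rows lie in disjoint intervals. -/
lemma rowParams_separated : ∀ R ∈ rowParams, ∀ R' ∈ rowParams, R = R' ∨
    2 * R.2.2.2.1 + R.2.2.2.2.1 + R'.2.2.2.2.2 + 1
      < 2 * R'.2.2.1 + R'.2.2.2.2.1 + R.2.2.2.2.2 ∨
    2 * R'.2.2.2.1 + R'.2.2.2.2.1 + R.2.2.2.2.2 + 1
      < 2 * R.2.2.1 + R.2.2.2.2.1 + R'.2.2.2.2.2 := by
  decide +kernel

lemma paramRow_eq_of_last_eq {R R' : ℕ × ℕ × ℕ × ℕ × ℕ × ℕ} (hR : R ∈ rowParams)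
    (hR' : R' ∈ rowParams) {x y : Fin 4 → ℕ} (hx : x ∈ paramRow R) (hy : y ∈ paramRow R')
    (h : x 3 = y 3) : R = R' ∧ x = y := by
  have h1 := (mem_block4Row (by have := rowParams_pos R hR; omega)).mp hx
  have h2 := (mem_block4Row (by have := rowParams_pos R' hR'; omega)).mp hy
  have hRR : R = R' := by
    rcases rowParams_separated R hR R' hR' with h' | h' | h' <;> omega
  subst hRR
  refine ⟨rfl, ?_⟩
  funext i
  fin_cases i
  · exact h1.1.trans h2.1.symm
  · exact h1.2.1.trans h2.2.1.symm
  · change x 2 = y 2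
    omega
  · exact h

lemma block4Rest_last_injective : ∀ x ∈ block4Rest, ∀ y ∈ block4Rest, x 3 = y 3 → x = y := by
  intro x hx y hy h
  rw [block4Rest_eq, Finset.mem_biUnion] at hx hy
  obtain ⟨R, hR, hx⟩ := hx
  obtain ⟨R', hR', hy⟩ := hy
  exact (paramRow_eq_of_last_eq (List.mem_toFinset.mp hR) (List.mem_toFinset.mp hR') hx hy h).2

lemma block4Rest_lt : ∀ x ∈ block4Rest, 1 ≤ x 3 ∧ ∀ i, x i < sizes4 i := by
  intro x hx
  rw [block4Rest_eq, Finset.mem_biUnion] at hx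
  obtain ⟨R, hR, hx⟩ := hx
  have hR := List.mem_toFinset.mp hR
  have h0 := rowParams_pos R hR
  have h1 := (mem_block4Row (by omega)).mp hx
  have h2 : ∀ R ∈ rowParams, R.1 < 7 ∧ R.2.1 < 3 ∧ R.2.2.2.1 < 13 ∧
      2 * R.2.2.2.1 + R.2.2.2.2.1 < 241 + R.2.2.2.2.2 := by
    decide +kernel
  have h2 := h2 R hR
  refine ⟨by omega, fun i => ?_⟩
  fin_cases i
  · change x 0 < 7
    omega
  · change x 1 < 3
    omega
  · change x 2 < 13
    omega
  · change x 3 < 241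
    omega

lemma block4Zero_lt : ∀ x ∈ block4Zero, x 3 = 0 ∧ ∀ i, x i < sizes4 i := by
  decide +kernel

lemma sum_block4 (f : ℕ → ℕ → ℕ → ℕ) : ∑ x ∈ block4Zero ∪ block4Rest, f (x 0) (x 1) (x 2)
    = (segments.map fun S =>
        S.1 * ∑ c ∈ Finset.Icc S.2.2.2.1 S.2.2.2.2, f S.2.1 S.2.2.1 c).sum := by
  rw [Finset.sum_union, segments, List.map_append, List.sum_append]
  · refine congrArg₂ (· + ·) ?_ ?_
    · rw [block4Zero_eq, List.sum_toFinset _ (by decide +kernel), List.map_map, List.map_map]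
      refine congrArg List.sum (List.map_congr_left fun z _ => ?_)
      simp
    · rw [block4Rest_eq, Finset.sum_biUnion, List.sum_toFinset _ (by decide +kernel), List.map_map]
      · refine congrArg List.sum (List.map_congr_left fun R hR => ?_)
        exact sum_block4Row (by have := rowParams_pos R hR; omega) f
      · intro R hR R' hR' hne
        refine Finset.disjoint_left.mpr fun x hx hx' => hne ?_
        exact (paramRow_eq_of_last_eq (List.mem_toFinset.mp hR) (List.mem_toFinset.mp hR')
          hx hx' rfl).1
  · refine Finset.disjoint_left.mpr fun x hx hx' => ?_
    have h1 := (block4Zero_lt x hx).1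
    have h2 := (block4Rest_lt x hx').1
    omega

lemma card_block4 : (block4Zero ∪ block4Rest).card = 257 := by
  have := sum_block4 fun _ _ _ => 1
  rw [Finset.card_eq_sum_ones, this]
  simp only [Finset.sum_const, Nat.card_Icc, smul_eq_mul, mul_one]
  decide +kernel

lemma card_block4Zero : block4Zero.card = 17 := by
  decide +kernel

lemma card_block4Rest : block4Rest.card = 240 := by
  have h := card_block4
  rw [Finset.card_union_of_disjoint, card_block4Zero] at h
  · omega
  · refine Finset.disjoint_left.mpr fun x hx hx' => ?_
    have h1 := (block4Zero_lt x hx).1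
    have h2 := (block4Rest_lt x hx').1
    omega

/-- The number of ordered pairs of points, one on each of two segments, that agree in those of the
first three coordinates which are selected by `s₀`, `s₁`, `s₂`. -/
def segmentPairs (s₀ s₁ s₂ : Bool) (S S' : ℕ × ℕ × ℕ × ℕ × ℕ) : ℕ :=
  if (s₀ = true → S.2.1 = S'.2.1) ∧ (s₁ = true → S.2.2.1 = S'.2.2.1) then
    S.1 * (S'.1 * if s₂ = true then
      min S.2.2.2.2 S'.2.2.2.2 + 1 - max S.2.2.2.1 S'.2.2.2.1
    else (S.2.2.2.2 + 1 - S.2.2.2.1) * (S'.2.2.2.2 + 1 - S'.2.2.2.1))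
  else 0

lemma sum_Icc_sum_Icc_ite (Q : Prop) [Decidable Q] (s₂ : Bool) (l u l' u' : ℕ) :
    ∑ c ∈ Finset.Icc l u, ∑ c' ∈ Finset.Icc l' u', (if Q ∧ (s₂ = true → c = c') then 1 else 0)
      = if Q then
          if s₂ = true then min u u' + 1 - max l l' else (u + 1 - l) * (u' + 1 - l')
        else 0 := by
  by_cases hQ : Q
  · cases s₂
    · simp [hQ]
    · simp only [hQ, true_and, forall_const, if_true, Finset.sum_ite_eq]
      rw [← Finset.card_filter, ← Nat.card_Icc]
      congr 1
      ext c
      simp only [Finset.mem_filter, Finset.mem_Icc]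
      omega
  · simp [hQ]

lemma sum_segmentPairs (s₀ s₁ s₂ : Bool) (S S' : ℕ × ℕ × ℕ × ℕ × ℕ) :
    S.1 * ∑ c ∈ Finset.Icc S.2.2.2.1 S.2.2.2.2, S'.1 * ∑ c' ∈ Finset.Icc S'.2.2.2.1 S'.2.2.2.2,
      (if (s₀ = true → S.2.1 = S'.2.1) ∧ (s₁ = true → S.2.2.1 = S'.2.2.1) ∧ (s₂ = true → c = c')
        then 1 else 0) = segmentPairs s₀ s₁ s₂ S S' := by
  simp only [← and_assoc]
  rw [← Finset.mul_sum, sum_Icc_sum_Icc_ite, segmentPairs]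
  split_ifs <;> simp

lemma sum_list_sum_map {α β : Type*} (s : Finset α) (L : List β) (g : α → β → ℕ) :
    ∑ c ∈ s, (L.map (g c)).sum = (L.map fun S => ∑ c ∈ s, g c S).sum := by
  induction L with
  | nil => simp
  | cons S L ih => simp [Finset.sum_add_distrib, ih]

/-- The number of pairs agreeing on a set of coordinates not containing the last one, for a set
whose points have the positions listed in `L`. -/
lemma agreeingPairs_eq_sum_segmentPairs {B : Finset (Fin 4 → ℕ)}
    {L : List (ℕ × ℕ × ℕ × ℕ × ℕ)}
    (hL : ∀ f : ℕ → ℕ → ℕ → ℕ, ∑ x ∈ B, f (x 0) (x 1) (x 2)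
      = (L.map fun S => S.1 * ∑ c ∈ Finset.Icc S.2.2.2.1 S.2.2.2.2, f S.2.1 S.2.2.1 c).sum)
    {I : Finset (Fin 4)} (hI : 3 ∉ I) :
    agreeingPairs B I = (L.map fun S => (L.map fun S' =>
      segmentPairs (decide (0 ∈ I)) (decide (1 ∈ I)) (decide (2 ∈ I)) S S').sum).sum := by
  have h : ∀ x y : Fin 4 → ℕ, (∀ i ∈ I, x i = y i) ↔ (decide (0 ∈ I) = true → x 0 = y 0) ∧
      (decide (1 ∈ I) = true → x 1 = y 1) ∧ (decide (2 ∈ I) = true → x 2 = y 2) := by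
    intro x y
    simp [Fin.forall_fin_succ, hI]
  simp only [agreeingPairs, h]
  rw [hL fun a b c => ∑ y ∈ B,
    if (decide (0 ∈ I) = true → a = y 0) ∧ (decide (1 ∈ I) = true → b = y 1) ∧
      (decide (2 ∈ I) = true → c = y 2) then 1 else 0]
  refine congrArg List.sum (List.map_congr_left fun S _ => ?_)
  have h2 := fun c => hL fun a' b' c' =>
    if (decide (0 ∈ I) = true → S.2.1 = a') ∧ (decide (1 ∈ I) = true → S.2.2.1 = b') ∧
      (decide (2 ∈ I) = true → c = c') then 1 else 0
  simp only [h2]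
  rw [sum_list_sum_map, ← List.sum_map_mul_left]
  refine congrArg List.sum (List.map_congr_left fun S' _ => ?_)
  rw [← sum_segmentPairs, ← Finset.mul_sum]

lemma segmentPairs_sum : ∀ I : Finset (Fin 4), 3 ∉ I →
    (segments.map fun S => (segments.map fun S' =>
      segmentPairs (decide (0 ∈ I)) (decide (1 ∈ I)) (decide (2 ∈ I)) S S').sum).sum + 1
      = 257 + ∏ i, if i ∈ I then 1 else sizes4 i := by
  decide +kernel

lemma agreeingPairs_block4Zero : ∀ I : Finset (Fin 4), 3 ∈ I →
    agreeingPairs block4Zero I + 241 = 257 + ∏ i, if i ∈ I then 1 else sizes4 i := by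
  decide +kernel

lemma agreeingPairs_block4 (I : Finset (Fin 4)) :
    agreeingPairs (block4Zero ∪ block4Rest) I + 1
      = (block4Zero ∪ block4Rest).card + ∏ i, if i ∈ I then 1 else sizes4 i := by
  rw [card_block4]
  by_cases hI : 3 ∈ I
  · rw [agreeingPairs_union hI, card_block4Rest]
    · exact agreeingPairs_block4Zero I hI
    · intro x hx y hy h
      have h1 := (block4Zero_lt x hx).1
      have h2 := (block4Rest_lt y hy).1
      omega
    · exact block4Rest_last_injective
  · rw [agreeingPairs_eq_sum_segmentPairs sum_block4 hI]
    exact segmentPairs_sum I hI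

lemma exists_isTwoDesign_design4 :
    ∃ lam, design4.IsTwoDesign (2 ^ 16 + 2 ^ 8 + 1) 257 lam := by
  have hprod : ∏ i, sizes4 i = 2 ^ 16 + 2 ^ 8 + 1 := by decide +kernel
  have key := gridStructure_isTwoDesign sizes4 (block4Zero ∪ block4Rest)
    (fun x hx => by
      rcases Finset.mem_union.mp hx with hx | hx
      · exact (block4Zero_lt x hx).2
      · exact (block4Rest_lt x hx).2)
    agreeingPairs_block4 (by rw [card_block4]; norm_num) (by rw [card_block4, hprod]; norm_num)
  rwa [card_block4, hprod] at key

theorem theorem1p2 :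
    (∀ p : ℕ, 1 < p →
      (∃ lam : ℕ, (design3 p).IsTwoDesign (p ^ 8 + p ^ 4 + 1) (p ^ 4 + 1) lam) ∧
      (design3 p).IsBlockTransitiveGridImprimitive 3) ∧
    (∀ p q : ℕ, 1 < p → 1 < q → p ≠ q → ¬ (design3 p).Isomorphic (design3 q)) ∧
    (∃ lam : ℕ, design4.IsTwoDesign (2 ^ 16 + 2 ^ 8 + 1) 257 lam) ∧
    design4.IsBlockTransitiveGridImprimitive 4 := by
  refine ⟨fun p hp => ⟨?_, ?_⟩, fun p q hp hq hne hiso => hne ?_, exists_isTwoDesign_design4, ?_⟩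
  · rcases Nat.lt_or_ge 2 p with h | h
    · exact exists_isTwoDesign_design3 h
    · obtain rfl : p = 2 := by omega
      exact exists_isTwoDesign_design3_two
  · exact gridStructure_isBlockTransitiveGridImprimitive (by norm_num) _ (one_lt_sizes3 hp) _
  · -- Isomorphic structures have equally many points, and `p ^ 8 + p ^ 4 + 1` determines `p`.
    have h := hiso.natCard_eq
    rw [natCard_grid_sizes3 hp, natCard_grid_sizes3 hq] at h
    rcases lt_trichotomy p q with hlt | heq | hlt
    · have h4 := Nat.pow_lt_pow_left hlt (n := 4) (by norm_num)
      have h8 := Nat.pow_lt_pow_left hlt (n := 8) (by norm_num)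
      omega
    · exact heq
    · have h4 := Nat.pow_lt_pow_left hlt (n := 4) (by norm_num)
      have h8 := Nat.pow_lt_pow_left hlt (n := 8) (by norm_num)
      omega
  · exact gridStructure_isBlockTransitiveGridImprimitive (by norm_num) _ (by decide) _
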